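/- Let $d\ge 2$, $\alpha\in(0,d-1)$, $Q>0$ and $m>0$. Let $|E|$ denote Lebesgue measure on $\mathbb R^d$, let $B$ be the open unit ball and $\omega_d=|B|$. Let $$P(E)=\sup\Big\{\int_E \operatorname{div}\varphi\,dx:\ \varphi\in C^1_c(\mathbb R^d;\mathbb R^d),\ |\varphi|\le 1\Big\}\in[0,\infty]$$ be the perimeter, and for a Borel set $A\subset\mathbb R^d$ let $$I_\alpha(A)=\inf\Big\{\iint_{\mathbb R^d\times\mathbb R^d}\frac{d\mu(x)\,d\mu(y)}{|x-y|^\alpha}:\ \mu\ \text{a non-negative Borel measure on }\mathbb R^d,\ \mu(A)=1\Big\}\in[0,\infty]$$ be the Riesz potential energy (with $\inf\emptyset=+\infty$). Set $$\mathcal F(E)=P(E)+Q^2I_\alpha(E),\qquad \mathcal G(E)=P(E)+Q^2I_\alpha(\partial E).$$ Let $\mathcal A$ be either the class of all open sets $E\subset\mathbb R^d$ with $|E|=m$, or the class of all compact sets $E\subset\mathbb R^d$ with $|E|=m$. Then $$\inf_{E\in\mathcal A}\mathcal F(E)=\inf_{E\in\mathcal A}\mathcal G(E)=\min_{E\in\mathcal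 A}P(E)=\Big(\frac{m}{\omega_d}\Big)^{\frac{d-1}{d}}P(B),$$ where the last minimum is attained. Moreover, neither $\mathcal F$ nor $\mathcal G$ has a minimizer in $\mathcal A$. -/

import Mathlib

open MeasureTheory
open scoped ENNReal

noncomputable section

namespace ChargedDrop

/-- `ℝ^d` with its Euclidean norm and Lebesgue measure. -/
abbrev Space (d : ℕ) : Type := EuclideanSpace ℝ (Fin d)

/-- The divergence `∑ᵢ ∂ᵢ φᵢ` of a vector field on `ℝ^d`. -/
def divergence {d : ℕ} (φ : Space d → Space d) (x : Space d) : ℝ :=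
  ∑ i : Fin d, (fderiv ℝ φ x (EuclideanSpace.single i 1)) i

/-- The (De Giorgi) perimeter of a set `E`, i.e. the total variation of its indicator function:
the supremum of `∫_E div φ` over `C¹` compactly supported vector fields with `|φ| ≤ 1`.
The truncation in `ENNReal.ofReal` is harmless, as `φ` can be replaced by `-φ`. -/
def perimeter {d : ℕ} (E : Set (Space d)) : ℝ≥0∞ :=
  ⨆ (φ : Space d → Space d) (_ : ContDiff ℝ 1 φ) (_ : HasCompactSupport φ)
    (_ : ∀ x, ‖φ x‖ ≤ 1), ENNReal.ofReal (∫ x in E, divergence φ x)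

/-- The energy `∬ |x - y|^{-α} dμ(x) dμ(y) ∈ [0, ∞]` of a non-negative Borel measure.
For `α > 0` the integrand is `∞` on the diagonal. -/
def measureEnergy {d : ℕ} (α : ℝ) (μ : Measure (Space d)) : ℝ≥0∞ :=
  ∫⁻ x, ∫⁻ y, (edist x y) ^ (-α) ∂μ ∂μ

/-- The Riesz potential energy `I_α(A)` of a set: the infimum of the energies of the non-negative
Borel measures with `μ(A) = 1`. -/
def rieszEnergy {d : ℕ} (α : ℝ) (A : Set (Space d)) : ℝ≥0∞ :=
  ⨅ (μ : Measure (Space d)) (_ : μ A = 1), measureEnergy α μ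

/-- `F(E) = P(E) + Q² I_α(E)`. -/
def energyF {d : ℕ} (α Q : ℝ) (E : Set (Space d)) : ℝ≥0∞ :=
  perimeter E + ENNReal.ofReal (Q ^ 2) * rieszEnergy α E

/-- `G(E) = P(E) + Q² I_α(∂E)`. -/
def energyG {d : ℕ} (α Q : ℝ) (E : Set (Space d)) : ℝ≥0∞ :=
  perimeter E + ENNReal.ofReal (Q ^ 2) * rieszEnergy α (frontier E)

/-- The open subsets of `ℝ^d` of Lebesgue measure `m`. -/
def openSetsOfVolume (d : ℕ) (m : ℝ) : Set (Set (Space d)) :=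
  {E | IsOpen E ∧ volume E = ENNReal.ofReal m}

/-- The compact subsets of `ℝ^d` of Lebesgue measure `m`. -/
def compactSetsOfVolume (d : ℕ) (m : ℝ) : Set (Set (Space d)) :=
  {E | IsCompact E ∧ volume E = ENNReal.ofReal m}

/-- The perimeter `(m / ω_d)^{(d-1)/d} P(B)` of a ball of volume `m`, where `B` is the unit ball
and `ω_d = |B|`. -/
def ballPerimeter (d : ℕ) (m : ℝ) : ℝ≥0∞ :=
  (ENNReal.ofReal m / volume (Metric.ball (0 : Space d) 1)) ^ (((d : ℝ) - 1) / (d : ℝ)) *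
    perimeter (Metric.ball (0 : Space d) 1)

end ChargedDrop

end

open MeasureTheory Set
open scoped ENNReal Pointwise

noncomputable section
namespace ChargedDrop

/-! Both energies dominate the perimeter, so the isoperimetric inequality bounds them below by the
perimeter of the ball. The bound is approached because charge can be made almost free: shrink the
ball slightly and put the lost volume into `N` satellites of radius `r = N ^ (-1/β)`, with `α < β <
d - 1`, far apart. Their perimeter, of order `N r^(d-1)`, tends to zero because `β < d - 1`; the
self-energy of a unit charge spread over them, of order `N⁻¹ r^(-α)`, tends to zero because `α < β`;
the interaction is small by distance (`exists_ball_with_satellites`).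

A minimizer would therefore have the perimeter of a ball and zero Riesz energy. Bounded sets have
positive energy, since the kernel is bounded below on them (`rieszEnergy_ne_zero_of_isBounded`), so
it remains to see that optimal sets are bounded. Compact sets are. For open sets the equality case
of the isoperimetric inequality is not needed: cutting an optimal set by a sphere and applying the
inequality to both parts gives `V(r+s)^p ≤ (A/s) V(r)` for the volume `V(r)` outside the ball of
radius `r`, with `p = (d-1)/d < 1`, and an iteration forces `V` to vanish at a finite radius
(`exists_volume_diff_ball_eq_zero`).

The isoperimetric inequality is obtained in functional form. Prékopa–Leindler gives the
Brunn–Minkowski inequality, hence a first-order lower bound for the volume of parallel sets.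
Integrated over the superlevel sets of a smooth `f`, it bounds the integral of `isoProfile d |{f >
t}|` over `t > 0` by the integral of `|∇f|`. Mollification and cutoff extend this to functions of
bounded variation (`VariationLE.lintegral_isoProfile_superlevel_le`). The functional form also
covers `1_E η` and `1_E (1 - η)` for a smooth cutoff `η`, so that cutting needs no slicing of `E` by
spheres. -/

/-! ### Brunn–Minkowski and Prékopa–Leindler inequalities. -/

/-- The one-dimensional Brunn–Minkowski inequality for compact sets. -/
theorem volume_add_le_volume_add_of_isCompact {K L : Set ℝ} (hK : IsCompact K) (hL : IsCompact L)
    (hK0 : K.Nonempty) (hL0 : L.Nonempty) : volume K + volume L ≤ volume (K + L) := by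
  -- With `a = max K` and `b = min L`, the translates `K + b` and `a + L` lie in `K + L` and meet at
  -- most in the point `a + b`.
  obtain ⟨a, ha, hamax⟩ := hK.exists_isGreatest hK0
  obtain ⟨b, hb, hbmin⟩ := hL.exists_isLeast hL0
  have h1 : (fun x => x + b) '' K ⊆ K + L := by
    rintro _ ⟨x, hx, rfl⟩; exact add_mem_add hx hb
  have h2 : (fun x => a + x) '' L ⊆ K + L := by
    rintro _ ⟨x, hx, rfl⟩; exact add_mem_add ha hx
  have hm : MeasurableSet ((fun x => a + x) '' L) :=
    (hL.image (continuous_const.add continuous_id)).measurableSet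
  have hd : AEDisjoint volume ((fun x => x + b) '' K) ((fun x => a + x) '' L) := by
    refine measure_mono_null (t := {a + b}) ?_ (by simp)
    rintro _ ⟨⟨x, hx, rfl⟩, ⟨y, hy, hxy⟩⟩
    have h3 := hamax hx
    have h4 := hbmin hy
    simp only [mem_singleton_iff]
    simp only at hxy
    linarith
  calc volume K + volume L
      = volume ((fun x => x + b) '' K) + volume ((fun x => a + x) '' L) := by
        simp
    _ = volume ((fun x => x + b) '' K ∪ (fun x => a + x) '' L) :=
        (measure_union₀ hm.nullMeasurableSet hd).symm
    _ ≤ volume (K + L) := measure_mono (union_subset h1 h2)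

/-- The one-dimensional Brunn–Minkowski inequality, in a form that does not require the sum set
to be measurable. -/
theorem volume_combo_le {A B C : Set ℝ} (hA : MeasurableSet A) (hB : MeasurableSet B)
    (hA0 : A.Nonempty) (hB0 : B.Nonempty) {s t : ℝ} (hs : 0 ≤ s) (ht : 0 ≤ t)
    (h : ∀ x ∈ A, ∀ y ∈ B, s * x + t * y ∈ C) :
    ENNReal.ofReal s * volume A + ENNReal.ofReal t * volume B ≤ volume C := by
  obtain ⟨x₀, hx₀⟩ := hA0
  obtain ⟨y₀, hy₀⟩ := hB0
  have key : ∀ K ⊆ A, IsCompact K → ∀ L ⊆ B, IsCompact L →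
      ENNReal.ofReal s * volume K + ENNReal.ofReal t * volume L ≤ volume C := by
    intro K hKA hK L hLB hL
    -- The inserted points keep both compact sets nonempty; with an empty set the sum would be
    -- empty.
    have hK' : IsCompact (s • insert x₀ K) := (hK.insert x₀).smul s
    have hL' : IsCompact (t • insert y₀ L) := (hL.insert y₀).smul t
    have h1 := volume_add_le_volume_add_of_isCompact hK' hL'
      ((insert_nonempty _ _).smul_set) ((insert_nonempty _ _).smul_set)
    rw [Measure.addHaar_smul, Measure.addHaar_smul] at h1
    simp only [Module.finrank_self, pow_one, abs_of_nonneg hs, abs_of_nonneg ht] at h1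
    refine le_trans (add_le_add ?_ ?_) (h1.trans (measure_mono ?_))
    · gcongr; exact subset_insert _ _
    · gcongr; exact subset_insert _ _
    · rintro _ ⟨_, ⟨x, hx, rfl⟩, _, ⟨y, hy, rfl⟩, rfl⟩
      exact h x (insert_subset hx₀ hKA hx) y (insert_subset hy₀ hLB hy)
  have hsupA : volume A = ⨆ K ∈ {K | K ⊆ A ∧ IsCompact K}, volume K := by
    rw [hA.measure_eq_iSup_isCompact]
    exact iSup_congr fun K => by simp [iSup_and]
  have hsupB : volume B = ⨆ K ∈ {K | K ⊆ B ∧ IsCompact K}, volume K := by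
    rw [hB.measure_eq_iSup_isCompact]
    exact iSup_congr fun K => by simp [iSup_and]
  rw [hsupA, hsupB]
  simp only [ENNReal.mul_iSup]
  exact ENNReal.biSup_add_biSup_le ⟨∅, by simp⟩ ⟨∅, by simp⟩
    fun K hK L hL => key K hK.1 hK.2 L hL.1 hL.2

/-- The weighted inequality of arithmetic and geometric means in `[0, ∞]`. -/
theorem ennreal_geom_mean_le_arith_mean {a b : ℝ} (ha : 0 < a) (hb : 0 < b) (hab : a + b = 1)
    (x y : ℝ≥0∞) : x ^ a * y ^ b ≤ ENNReal.ofReal a * x + ENNReal.ofReal b * y := by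
  by_cases hx : x = ⊤
  · simp [hx, ENNReal.mul_top, ha]
  by_cases hy : y = ⊤
  · simp [hy, ENNReal.mul_top, hb]
  lift x to NNReal using hx
  lift y to NNReal using hy
  lift a to NNReal using ha.le
  lift b to NNReal using hb.le
  have h := NNReal.geom_mean_le_arith_mean2_weighted a b x y (by exact_mod_cast hab)
  rw [← ENNReal.coe_rpow_of_nonneg _ ha.le, ← ENNReal.coe_rpow_of_nonneg _ hb.le,
    ENNReal.ofReal_coe_nnreal, ENNReal.ofReal_coe_nnreal]
  exact_mod_cast h

/-- The layer cake formula for `[0, 1]`-valued functions. -/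
theorem lintegral_min_one_eq {α : Type*} [MeasurableSpace α] (μ : Measure α) {f : α → ℝ≥0∞}
    (hf : Measurable f) :
    ∫⁻ x, min (f x) 1 ∂μ = ∫⁻ t in Ioo (0 : ℝ) 1, μ {x | ENNReal.ofReal t < f x} := by
  have hne : ∀ x, min (f x) 1 ≠ ⊤ := fun x => ne_top_of_le_ne_top ENNReal.one_ne_top
    (min_le_right _ _)
  have h1 : ∫⁻ x, min (f x) 1 ∂μ = ∫⁻ x, ENNReal.ofReal (min (f x) 1).toReal ∂μ :=
    lintegral_congr fun x => (ENNReal.ofReal_toReal (hne x)).symm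
  rw [h1, lintegral_eq_lintegral_meas_lt μ (Filter.Eventually.of_forall fun x =>
    ENNReal.toReal_nonneg) (hf.min measurable_const).ennreal_toReal.aemeasurable,
    ← Ioo_union_Ici_eq_Ioi (zero_lt_one (α := ℝ)), lintegral_union measurableSet_Ici
      (disjoint_left.2 fun x hx hx' => hx.2.not_ge hx')]
  have h2 : ∫⁻ t in Ici (1 : ℝ), μ {x | t < (min (f x) 1).toReal} = 0 := by
    rw [setLIntegral_congr_fun (g := fun _ => 0) measurableSet_Ici, lintegral_zero]
    intro t ht
    have : {x | t < (min (f x) 1).toReal} = ∅ := by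
      ext x
      simp only [mem_ofPred_eq, mem_empty_iff_false, iff_false, not_lt]
      refine le_trans ?_ (mem_Ici.1 ht)
      exact ENNReal.toReal_le_of_le_ofReal zero_le_one (by simp)
    simp [this]
  rw [h2, add_zero]
  refine setLIntegral_congr_fun measurableSet_Ioo fun t ht => ?_
  congr 1
  ext x
  simp only [mem_ofPred_eq]
  rw [← ENNReal.ofReal_lt_iff_lt_toReal ht.1.le (hne x), lt_min_iff]
  simp [ht.2]

/-- The Prékopa–Leindler inequality on the line, for functions with supremum `1`. -/
theorem lintegral_combo_le_of_iSup_eq_one {f g h : ℝ → ℝ≥0∞} (hf : Measurable f)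
    (hg : Measurable g) (hh : Measurable h) {a b : ℝ} (ha : 0 < a) (hb : 0 < b) (hab : a + b = 1)
    (hfgh : ∀ x y, f x ^ a * g y ^ b ≤ h (a * x + b * y))
    (hf1 : ⨆ x, f x = 1) (hg1 : ⨆ x, g x = 1) :
    ENNReal.ofReal a * (∫⁻ x, f x) + ENNReal.ofReal b * ∫⁻ x, g x ≤ ∫⁻ x, h x := by
  have hfm : ∀ x, min (f x) 1 = f x := fun x => min_eq_left (hf1 ▸ le_iSup f x)
  have hgm : ∀ x, min (g x) 1 = g x := fun x => min_eq_left (hg1 ▸ le_iSup g x)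
  have e1 := lintegral_min_one_eq volume hf
  have e2 := lintegral_min_one_eq volume hg
  simp only [hfm] at e1
  simp only [hgm] at e2
  refine le_trans ?_ (lintegral_mono fun x => min_le_left (h x) 1)
  rw [lintegral_min_one_eq volume hh, e1, e2]
  have mono : ∀ u : ℝ → ℝ≥0∞, Measurable fun t : ℝ => volume {x | ENNReal.ofReal t < u x} :=
    fun u => Antitone.measurable fun s t hst => measure_mono fun x hx =>
      lt_of_le_of_lt (ENNReal.ofReal_le_ofReal hst) hx
  rw [← lintegral_const_mul _ (mono f), ← lintegral_const_mul _ (mono g),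
    ← lintegral_add_left ((mono f).const_mul _)]
  -- For `t < 1` both superlevel sets are nonempty because the suprema are 1, and `t = t^a t^b`
  -- places `a{f > t} + b{g > t}` inside `{h > t}`.
  refine setLIntegral_mono' measurableSet_Ioo fun t ht => ?_
  have ht1 : ENNReal.ofReal t < 1 := by simpa using ht.2
  refine volume_combo_le (measurableSet_lt measurable_const hf)
    (measurableSet_lt measurable_const hg) (let ⟨x, hx⟩ := lt_iSup_iff.1 (hf1 ▸ ht1); ⟨x, hx⟩)
    (let ⟨x, hx⟩ := lt_iSup_iff.1 (hg1 ▸ ht1); ⟨x, hx⟩) ha.le hb.le fun x hx y hy => ?_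
  simp only [mem_ofPred_eq] at hx hy ⊢
  refine lt_of_lt_of_le ?_ (hfgh x y)
  have ht0 : ENNReal.ofReal t ≠ 0 := by simpa using ht.1
  calc ENNReal.ofReal t = ENNReal.ofReal t ^ a * ENNReal.ofReal t ^ b := by
        rw [← ENNReal.rpow_add _ _ ht0 ENNReal.ofReal_ne_top, hab, ENNReal.rpow_one]
    _ < f x ^ a * g y ^ b :=
        ENNReal.mul_lt_mul (ENNReal.rpow_lt_rpow hx ha) (ENNReal.rpow_lt_rpow hy hb)

/-- The Prékopa–Leindler inequality on the line, for bounded functions. -/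
theorem prekopaLeindler_real_of_bounded {f g h : ℝ → ℝ≥0∞} (hf : Measurable f)
    (hg : Measurable g) (hh : Measurable h) {a b : ℝ} (ha : 0 < a) (hb : 0 < b) (hab : a + b = 1)
    (hfgh : ∀ x y, f x ^ a * g y ^ b ≤ h (a * x + b * y))
    (hf1 : ⨆ x, f x ≠ ⊤) (hg1 : ⨆ x, g x ≠ ⊤) :
    (∫⁻ x, f x) ^ a * (∫⁻ x, g x) ^ b ≤ ∫⁻ x, h x := by
  set M := ⨆ x, f x with hM
  set N := ⨆ x, g x with hN
  by_cases hM0 : M = 0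
  · have : ∀ x, f x = 0 := fun x => le_antisymm (hM0 ▸ le_iSup f x) bot_le
    simp [this, ha]
  by_cases hN0 : N = 0
  · have : ∀ x, g x = 0 := fun x => le_antisymm (hN0 ▸ le_iSup g x) bot_le
    simp [this, hb]
  have hMa : M ^ a ≠ 0 := by simp [hM0, hf1]
  have hMt : M ^ a ≠ ⊤ := ENNReal.rpow_ne_top_of_nonneg ha.le hf1
  have hNa : N ^ b ≠ 0 := by simp [hN0, hg1]
  have hNt : N ^ b ≠ ⊤ := ENNReal.rpow_ne_top_of_nonneg hb.le hg1
  -- After normalizing the suprema to 1 the additive inequality holds; the arithmetic–geometric mean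
  -- turns it into the product form, which is homogeneous, so the constants cancel.
  have key := lintegral_combo_le_of_iSup_eq_one (f := fun x => M⁻¹ * f x)
    (g := fun x => N⁻¹ * g x) (h := fun x => ((M ^ a)⁻¹ * (N ^ b)⁻¹) * h x)
    (hf.const_mul _) (hg.const_mul _) (hh.const_mul _) ha hb hab (fun x y => by
      rw [ENNReal.mul_rpow_of_nonneg _ _ ha.le, ENNReal.mul_rpow_of_nonneg _ _ hb.le,
        ENNReal.inv_rpow, ENNReal.inv_rpow, mul_mul_mul_comm]
      gcongr
      exact hfgh x y)
    (by rw [← ENNReal.mul_iSup, ← hM, ENNReal.inv_mul_cancel hM0 hf1])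
    (by rw [← ENNReal.mul_iSup, ← hN, ENNReal.inv_mul_cancel hN0 hg1])
  replace key := (ennreal_geom_mean_le_arith_mean ha hb hab _ _).trans key
  rw [lintegral_const_mul _ hf, lintegral_const_mul _ hg, lintegral_const_mul _ hh,
    ENNReal.mul_rpow_of_nonneg _ _ ha.le, ENNReal.mul_rpow_of_nonneg _ _ hb.le,
    ENNReal.inv_rpow, ENNReal.inv_rpow, mul_mul_mul_comm] at key
  refine (ENNReal.mul_le_mul_iff_right ?_ ?_).1 key
  · exact mul_ne_zero (ENNReal.inv_ne_zero.2 hMt) (ENNReal.inv_ne_zero.2 hNt)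
  · exact ENNReal.mul_ne_top (ENNReal.inv_ne_top.2 hMa) (ENNReal.inv_ne_top.2 hNa)

theorem iSup_min_natCast (x : ℝ≥0∞) : ⨆ n : ℕ, min x n = x := by
  refine le_antisymm (iSup_le fun n => min_le_left _ _) ?_
  refine le_of_forall_lt fun c hc => ?_
  obtain ⟨n, hn⟩ := ENNReal.exists_nat_gt (ne_top_of_lt hc)
  exact lt_iSup_iff.2 ⟨n, lt_min hc hn⟩

/-- The Prékopa–Leindler inequality on the line. -/
theorem prekopaLeindler_real {f g h : ℝ → ℝ≥0∞} (hf : Measurable f)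
    (hg : Measurable g) (hh : Measurable h) {a b : ℝ} (ha : 0 < a) (hb : 0 < b) (hab : a + b = 1)
    (hfgh : ∀ x y, f x ^ a * g y ^ b ≤ h (a * x + b * y)) :
    (∫⁻ x, f x) ^ a * (∫⁻ x, g x) ^ b ≤ ∫⁻ x, h x := by
  have hmono : ∀ u : ℝ → ℝ≥0∞, Monotone fun (n : ℕ) x => min (u x) (n : ℝ≥0∞) :=
    fun u n m hnm x => min_le_min le_rfl (by exact_mod_cast hnm)
  have trunc : ∀ u : ℝ → ℝ≥0∞, Measurable u →
      Filter.Tendsto (fun n : ℕ => ∫⁻ x, min (u x) n) Filter.atTop (nhds (∫⁻ x, u x)) := by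
    intro u hu
    have e : ∫⁻ x, u x = ⨆ n : ℕ, ∫⁻ x, min (u x) n := by
      rw [← lintegral_iSup (fun n => hu.min measurable_const) (hmono u)]
      exact lintegral_congr fun x => (iSup_min_natCast _).symm
    rw [e]
    exact tendsto_atTop_iSup fun n m hnm => lintegral_mono (hmono u hnm)
  -- Excluding zero integrals keeps the limit of the product away from `0 * ∞`.
  by_cases hf0 : ∫⁻ x, f x = 0
  · simp [hf0, ha]
  by_cases hg0 : ∫⁻ x, g x = 0
  · simp [hg0, hb]
  have lim := ENNReal.Tendsto.mul
    ((ENNReal.continuous_rpow_const (y := a)).continuousAt.tendsto.comp (trunc f hf))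
    (Or.inl (by simp [hf0, ha.not_gt]))
    ((ENNReal.continuous_rpow_const (y := b)).continuousAt.tendsto.comp (trunc g hg))
    (Or.inl (by simp [hg0, hb.not_gt]))
  refine le_of_tendsto' lim fun n => ?_
  refine prekopaLeindler_real_of_bounded (hf.min measurable_const) (hg.min measurable_const) hh
    ha hb hab (fun x y => le_trans ?_ (hfgh x y)) ?_ ?_
  · gcongr <;> exact min_le_left _ _
  · exact ne_top_of_le_ne_top (ENNReal.natCast_ne_top n) (iSup_le fun x => min_le_right _ _)
  · exact ne_top_of_le_ne_top (ENNReal.natCast_ne_top n) (iSup_le fun x => min_le_right _ _)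

theorem lintegral_fin_succ {n : ℕ} {f : (Fin (n + 1) → ℝ) → ℝ≥0∞} (hf : Measurable f) :
    ∫⁻ x, f x = ∫⁻ t : ℝ, ∫⁻ y : Fin n → ℝ, f (Fin.cons t y) := by
  have h := (volume_preserving_piFinSuccAbove (fun _ : Fin (n + 1) => ℝ) 0).symm
  rw [← h.lintegral_comp hf]
  change ∫⁻ z : ℝ × (Fin n → ℝ), f (Fin.insertNth 0 z.1 z.2) ∂(volume.prod volume) = _
  rw [lintegral_prod]
  · simp
  · exact (hf.comp (MeasurableEquiv.piFinSuccAbove (fun _ : Fin (n + 1) => ℝ) 0).symm.measurable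
      ).aemeasurable

theorem measurable_finCons {n : ℕ} :
    Measurable fun z : ℝ × (Fin n → ℝ) => (Fin.cons z.1 z.2 : Fin (n + 1) → ℝ) := by
  refine measurable_pi_lambda _ fun i => ?_
  refine Fin.cases ?_ (fun j => ?_) i
  · simpa using measurable_fst
  · exact (measurable_pi_apply j).comp measurable_snd

/-- The Prékopa–Leindler inequality. -/
theorem prekopaLeindler {n : ℕ} {f g h : (Fin n → ℝ) → ℝ≥0∞} (hf : Measurable f)
    (hg : Measurable g) (hh : Measurable h) {a b : ℝ} (ha : 0 < a) (hb : 0 < b) (hab : a + b = 1)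
    (hfgh : ∀ x y, f x ^ a * g y ^ b ≤ h (a • x + b • y)) :
    (∫⁻ x, f x) ^ a * (∫⁻ x, g x) ^ b ≤ ∫⁻ x, h x := by
  induction n with
  | zero =>
    have e : ∀ u : (Fin 0 → ℝ) → ℝ≥0∞, ∫⁻ x, u x = u default := fun u => by
      rw [lintegral_unique, volume_pi, Measure.pi_of_empty _ default, measure_univ, mul_one]
      exact congrArg u (Subsingleton.elim _ _)
    rw [e, e, e]
    convert hfgh default default
  | succ n ih =>
    rw [lintegral_fin_succ hf, lintegral_fin_succ hg, lintegral_fin_succ hh]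
    have meas : ∀ u : (Fin (n + 1) → ℝ) → ℝ≥0∞, Measurable u →
        Measurable fun t : ℝ => ∫⁻ y : Fin n → ℝ, u (Fin.cons t y) := fun u hu =>
      (hu.comp measurable_finCons).lintegral_prod_right'
    have sec : ∀ u : (Fin (n + 1) → ℝ) → ℝ≥0∞, Measurable u → ∀ t : ℝ,
        Measurable fun y : Fin n → ℝ => u (Fin.cons t y) := fun u hu t =>
      (hu.comp measurable_finCons).comp measurable_prodMk_left
    -- The induction hypothesis on the slices at heights `s`, `t` and `a * s + b * t` is the
    -- one-dimensional hypothesis for the slice integrals.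
    refine prekopaLeindler_real (meas f hf) (meas g hg) (meas h hh) ha hb hab fun s t => ?_
    refine ih (sec f hf s) (sec g hg t) (sec h hh _) fun x y => ?_
    convert hfgh (Fin.cons s x) (Fin.cons t y) using 2
    ext i
    refine Fin.cases ?_ (fun j => ?_) i <;> simp

/-- The multiplicative Brunn–Minkowski inequality. -/
theorem volume_rpow_mul_volume_rpow_le {d : ℕ} {A B C : Set (Space d)} (hA : MeasurableSet A)
    (hB : MeasurableSet B) (hC : MeasurableSet C) {a b : ℝ} (ha : 0 < a) (hb : 0 < b)
    (hab : a + b = 1) (h : ∀ x ∈ A, ∀ y ∈ B, a • x + b • y ∈ C) :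
    volume A ^ a * volume B ^ b ≤ volume C := by
  have hp := PiLp.volume_preserving_toLp (Fin d)
  have e : ∀ S : Set (Space d), MeasurableSet S →
      volume S = ∫⁻ x : Fin d → ℝ, S.indicator 1 (WithLp.toLp 2 x) := fun S hS => by
    rw [hp.lintegral_comp (measurable_one.indicator hS), lintegral_indicator_one hS]
  have m : ∀ S : Set (Space d), MeasurableSet S →
      Measurable fun x : Fin d → ℝ => S.indicator (1 : Space d → ℝ≥0∞) (WithLp.toLp 2 x) :=
    fun S hS => (measurable_one.indicator hS).comp hp.measurable
  rw [e A hA, e B hB, e C hC]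
  refine prekopaLeindler (m A hA) (m B hB) (m C hC) ha hb hab fun x y => ?_
  by_cases hx : WithLp.toLp 2 x ∈ A
  · by_cases hy : WithLp.toLp 2 y ∈ B
    · have := h _ hx _ hy
      rw [← WithLp.toLp_smul, ← WithLp.toLp_smul, ← WithLp.toLp_add] at this
      rw [indicator_of_mem hx, indicator_of_mem hy, indicator_of_mem this]
      simp
    · simp [hy, hb]
  · simp [hx, ha]

/-! ### The isoperimetric profile and the volume of parallel sets. -/

/-- The perimeter of a ball of volume `v` in `ℝ^d`. -/
def isoProfile (d : ℕ) (v : ℝ≥0∞) : ℝ≥0∞ :=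
  d * volume (Metric.ball (0 : Space d) 1) *
    (v / volume (Metric.ball (0 : Space d) 1)) ^ (((d : ℝ) - 1) / (d : ℝ))

theorem volume_unitBall_ne_zero (d : ℕ) : volume (Metric.ball (0 : Space d) 1) ≠ 0 :=
  (Metric.measure_ball_pos _ _ zero_lt_one).ne'

theorem volume_unitBall_ne_top (d : ℕ) : volume (Metric.ball (0 : Space d) 1) ≠ ⊤ :=
  measure_ball_lt_top.ne

theorem isoProfile_ball {d : ℕ} (hd : 2 ≤ d) {r : ℝ} (hr : 0 ≤ r) :
    isoProfile d (ENNReal.ofReal (r ^ d) * volume (Metric.ball (0 : Space d) 1)) =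
      d * volume (Metric.ball (0 : Space d) 1) * ENNReal.ofReal (r ^ (d - 1)) := by
  have hd0 : (0 : ℝ) < d := by positivity
  have hd1 : (0 : ℝ) ≤ (d : ℝ) - 1 := by
    have : (2 : ℝ) ≤ d := by exact_mod_cast hd
    linarith
  rw [isoProfile, ENNReal.mul_div_cancel_right (volume_unitBall_ne_zero d)
    (volume_unitBall_ne_top d), ENNReal.ofReal_rpow_of_nonneg (by positivity) (by positivity)]
  congr 2
  rw [← Real.rpow_natCast, ← Real.rpow_mul hr, mul_div_cancel₀ _ hd0.ne', ← Real.rpow_natCast,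
    Nat.cast_sub (by omega), Nat.cast_one]

theorem isoProfile_zero {d : ℕ} (hd : 2 ≤ d) : isoProfile d 0 = 0 := by
  have h := isoProfile_ball hd le_rfl
  rw [zero_pow (by omega), zero_pow (by omega)] at h
  simpa using h

theorem isoProfile_mono (d : ℕ) (hd : 2 ≤ d) : Monotone (isoProfile d) := by
  intro v w hvw
  have hd1 : (0 : ℝ) ≤ (d : ℝ) - 1 := by
    have : (2 : ℝ) ≤ d := by exact_mod_cast hd
    linarith
  unfold isoProfile
  gcongr

theorem exists_radius_of_volume {d : ℕ} (hd : 2 ≤ d) {v : ℝ≥0∞} (hv : v ≠ ⊤) :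
    ∃ r : ℝ, 0 ≤ r ∧ v = ENNReal.ofReal (r ^ d) * volume (Metric.ball (0 : Space d) 1) := by
  have h1 : v / volume (Metric.ball (0 : Space d) 1) ≠ ⊤ :=
    ENNReal.div_ne_top hv (volume_unitBall_ne_zero d)
  refine ⟨(v / volume (Metric.ball (0 : Space d) 1)).toReal ^ ((d : ℝ)⁻¹), by positivity, ?_⟩
  rw [Real.rpow_inv_natCast_pow ENNReal.toReal_nonneg (by omega), ENNReal.ofReal_toReal h1,
    ENNReal.div_mul_cancel (volume_unitBall_ne_zero d) (volume_unitBall_ne_top d)]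

/-- The Brunn–Minkowski inequality for the parallel set of an open set, to first order. -/
theorem volume_add_isoProfile_le_volume_thickening {d : ℕ} (hd : 2 ≤ d) {A : Set (Space d)}
    (hA : IsOpen A) (hAt : volume A ≠ ⊤) {ε : ℝ} (hε : 0 < ε) :
    volume A + ENNReal.ofReal ε * isoProfile d (volume A) ≤ volume (Metric.thickening ε A) := by
  rcases A.eq_empty_or_nonempty with rfl | hne
  · simp [isoProfile_zero hd]
  obtain ⟨r, hr0, hr⟩ := exists_radius_of_volume hd hAt
  set w := volume (Metric.ball (0 : Space d) 1) with hw
  have hr1 : 0 < r := by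
    refine lt_of_le_of_ne hr0 fun h => ?_
    rw [← h, zero_pow (by omega)] at hr
    simp only [ENNReal.ofReal_zero, zero_mul] at hr
    exact (hA.measure_pos volume hne).ne' hr
  have hre : 0 < r + ε := by positivity
  have hscale : volume ((r⁻¹ : ℝ) • A) = w := by
    rw [Measure.addHaar_smul, hr, ← mul_assoc, ← ENNReal.ofReal_mul (abs_nonneg _),
      finrank_euclideanSpace_fin, abs_of_pos (by positivity), inv_pow,
      inv_mul_cancel₀ (by positivity)]
    simp
  -- With these weights `a • (A / r) + b • B` is `(A + εB) / (r + ε)`. Both `A / r` and `B` have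
  -- volume `w`, so the product inequality reads `w ≤ |A + εB| / (r + ε)^d`; Bernoulli's inequality
  -- then extracts the first order in `ε`.
  have key := volume_rpow_mul_volume_rpow_le (A := (r⁻¹ : ℝ) • A) (B := Metric.ball (0 : Space d) 1)
    (C := ((r + ε)⁻¹ : ℝ) • Metric.thickening ε A) (a := r / (r + ε)) (b := ε / (r + ε))
    (hA.smul₀ (by positivity)).measurableSet Metric.isOpen_ball.measurableSet
    (Metric.isOpen_thickening.smul₀ (by positivity)).measurableSet (by positivity) (by positivity)
    (by field_simp) (by
      rintro _ ⟨x, hx, rfl⟩ y hy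
      refine ⟨x + ε • y, Metric.mem_thickening_iff.2 ⟨x, hx, ?_⟩, ?_⟩
      · rw [mem_ball_zero_iff] at hy
        simp only [dist_eq_norm, add_sub_cancel_left, norm_smul, Real.norm_eq_abs, abs_of_pos hε]
        nlinarith
      · simp only [smul_add, smul_smul]
        congr 2 <;> field_simp)
  rw [hscale, ← hw, ← ENNReal.rpow_add _ _ (volume_unitBall_ne_zero d) (volume_unitBall_ne_top d),
    ← add_div, div_self hre.ne', ENNReal.rpow_one, Measure.addHaar_smul,
    finrank_euclideanSpace_fin, abs_of_pos (by positivity)] at key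
  have h1 : ENNReal.ofReal ((r + ε) ^ d) * w ≤ volume (Metric.thickening ε A) := by
    calc ENNReal.ofReal ((r + ε) ^ d) * w
        ≤ ENNReal.ofReal ((r + ε) ^ d) * (ENNReal.ofReal ((r + ε)⁻¹ ^ d) *
          volume (Metric.thickening ε A)) := by gcongr
      _ = volume (Metric.thickening ε A) := by
        rw [← mul_assoc, ← ENNReal.ofReal_mul (by positivity), inv_pow,
          mul_inv_cancel₀ (by positivity)]
        simp
  have h2 : r ^ d + ε * (d * r ^ (d - 1)) ≤ (r + ε) ^ d := by
    have := pow_add_mul_le_add_pow (a := r) (b := ε) hr0 (by linarith) d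
    nlinarith
  refine le_trans ?_ ((mul_le_mul_left (ENNReal.ofReal_le_ofReal h2) w).trans h1)
  rw [hr, hw, isoProfile_ball hd hr0, ENNReal.ofReal_add (by positivity) (by positivity),
    ENNReal.ofReal_mul hε.le, ENNReal.ofReal_mul (by positivity), ENNReal.ofReal_natCast]
  exact le_of_eq (by ring)

/-! ### The Sobolev inequality for smooth functions. -/

theorem measurable_isoProfile_superlevel {d : ℕ} (hd : 2 ≤ d) (u : Space d → ℝ) :
    Measurable fun t : ℝ => isoProfile d (volume {x | t < u x}) :=
  Antitone.measurable fun _ t hst => isoProfile_mono d hd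
    (measure_mono fun x (hx : t < u x) => lt_of_le_of_lt hst hx)

/-- On the `ε`-ball around `z` the gradient is at most `‖∇f(z)‖ + η`, so by the mean value
inequality `f(z)` lies below a nearby value by at most `ε (‖∇f(z)‖ + η)`. -/
theorem thickening_superlevel_subset {d : ℕ} {f : Space d → ℝ} (hf : ContDiff ℝ 1 f) {ε η : ℝ}
    (hε : 0 < ε) (hη : ∀ x y, dist x y < ε → ‖fderiv ℝ f x - fderiv ℝ f y‖ ≤ η) (t : ℝ) :
    Metric.thickening ε {x | t < f x} ⊆ {x | t < f x + ε * (‖fderiv ℝ f x‖ + η)} := by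
  intro z hz
  obtain ⟨x, hx, hxz⟩ := Metric.mem_thickening_iff.1 hz
  simp only [mem_ofPred_eq] at hx ⊢
  have h := (convex_ball z ε).norm_image_sub_le_of_norm_fderiv_le (𝕜 := ℝ) (f := f)
    (C := ‖fderiv ℝ f z‖ + η) (fun w _ => (hf.differentiable one_ne_zero) w) (fun w hw => by
      have h1 := hη w z hw
      have h2 := norm_le_norm_add_norm_sub' (fderiv ℝ f w) (fderiv ℝ f z)
      linarith)
    (Metric.mem_ball_self hε) (show x ∈ Metric.ball z ε by rwa [Metric.mem_ball, dist_comm])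
  have h0 : 0 ≤ ‖fderiv ℝ f z‖ + η := by
    have := hη z z (by simpa using hε)
    have := norm_nonneg (fderiv ℝ f z - fderiv ℝ f z)
    have := norm_nonneg (fderiv ℝ f z)
    linarith
  have h3 : f x - f z ≤ (‖fderiv ℝ f z‖ + η) * ε :=
    (le_abs_self _).trans (h.trans (mul_le_mul_of_nonneg_left
      (by rw [← dist_eq_norm, dist_comm]; exact hxz.le) h0))
  linarith

/-- The sharp Sobolev inequality for continuously differentiable functions, in terms of the
volumes of the superlevel sets. -/
theorem lintegral_isoProfile_superlevel_le_lintegral_fderiv {d : ℕ} (hd : 2 ≤ d) {f : Space d → ℝ}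
    (hf : ContDiff ℝ 1 f) (hfc : HasCompactSupport f) (hf0 : ∀ x, 0 ≤ f x) :
    ∫⁻ t in Ioi (0 : ℝ), isoProfile d (volume {x | t < f x}) ≤ ∫⁻ x, ‖fderiv ℝ f x‖ₑ := by
  have hK : IsCompact (Metric.cthickening 1 (tsupport f)) := hfc.isCompact.cthickening
  set K := Metric.cthickening 1 (tsupport f) with hKdef
  have hKm : MeasurableSet K := hK.measurableSet
  have hfd : Continuous (fderiv ℝ f) := hf.continuous_fderiv one_ne_zero
  have huc : UniformContinuous (fderiv ℝ f) :=
    (hfc.fderiv ℝ).uniformContinuous_of_continuous hfd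
  have step : ∀ η : ℝ, 0 < η → ∫⁻ t in Ioi (0 : ℝ), isoProfile d (volume {x | t < f x}) ≤
      (∫⁻ x, ‖fderiv ℝ f x‖ₑ) + ENNReal.ofReal η * volume K := by
    intro η hη
    obtain ⟨δ, hδ, hδη⟩ := Metric.uniformContinuous_iff.1 huc η hη
    set ε := min δ 1 with hεdef
    have hε : 0 < ε := lt_min hδ one_pos
    -- Restricting to `K`, which contains the `ε`-neighbourhood of the support as `ε ≤ 1`, makes the
    -- constant `η` contribute only `η |K|`.
    set F : Space d → ℝ := K.indicator fun x => f x + ε * (‖fderiv ℝ f x‖ + η) with hF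
    have hFm : Measurable F := by
      refine Measurable.indicator ?_ hKm
      exact (hf.continuous.add (continuous_const.mul (hfd.norm.add continuous_const))).measurable
    have hF0 : ∀ x, 0 ≤ F x := fun x => indicator_nonneg (fun x _ => by
      have := hf0 x; positivity) x
    have hsub : ∀ t : ℝ, 0 < t → Metric.thickening ε {x | t < f x} ⊆ {x | t < F x} := by
      intro t ht z hz
      have h1 := thickening_superlevel_subset hf hε (η := η) (fun x y hxy => by
        have := hδη (lt_of_lt_of_le hxy (min_le_left _ _))
        rw [dist_eq_norm] at this
        exact this.le) t hz
      have hzK : z ∈ K := by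
        obtain ⟨x, hx, hxz⟩ := Metric.mem_thickening_iff.1 hz
        refine Metric.mem_cthickening_of_dist_le z x 1 _ (subset_tsupport f ?_)
          (hxz.le.trans (min_le_right _ _))
        exact (lt_trans ht hx).ne'
      simpa [hF, hzK] using h1
    have hfin : ∀ t : ℝ, 0 < t → volume {x | t < f x} ≠ ⊤ := fun t ht =>
      ne_top_of_le_ne_top hfc.isCompact.measure_lt_top.ne
        (measure_mono fun x (hx : t < f x) => subset_tsupport f (ht.trans hx).ne')
    have hBM : ∀ t ∈ Ioi (0 : ℝ), volume {x | t < f x} +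
        ENNReal.ofReal ε * isoProfile d (volume {x | t < f x}) ≤ volume {x | t < F x} :=
      fun t ht => (volume_add_isoProfile_le_volume_thickening hd
        (isOpen_lt continuous_const hf.continuous) (hfin t ht) hε).trans (measure_mono (hsub t ht))
    have hmeas : Measurable fun t : ℝ => volume {x | t < f x} := Antitone.measurable
      fun s t hst => measure_mono fun x (hx : t < f x) => lt_of_le_of_lt hst hx
    -- By the layer cake formula the volumes integrate over `t` to the integrals of `f` and `F`; the
    -- integral of `f` then cancels and `ε` divides out.
    have h1 := setLIntegral_mono' (μ := volume) measurableSet_Ioi hBM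
    rw [lintegral_add_left hmeas, ← lintegral_eq_lintegral_meas_lt volume
      (Filter.Eventually.of_forall hf0) hf.continuous.aemeasurable,
      ← lintegral_eq_lintegral_meas_lt volume (Filter.Eventually.of_forall hF0)
      hFm.aemeasurable, lintegral_const_mul _ (measurable_isoProfile_superlevel hd f)] at h1
    have h2 : ∫⁻ x, ENNReal.ofReal (F x) ≤ (∫⁻ x, ENNReal.ofReal (f x)) +
        ENNReal.ofReal ε * ((∫⁻ x, ‖fderiv ℝ f x‖ₑ) + ENNReal.ofReal η * volume K) := by
      have h3 : ∀ x, ENNReal.ofReal (F x) ≤ ENNReal.ofReal (f x) +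
          ENNReal.ofReal ε * (‖fderiv ℝ f x‖ₑ + K.indicator (fun _ => ENNReal.ofReal η) x) := by
        intro x
        by_cases hx : x ∈ K
        · simp only [hF, indicator_of_mem hx]
          rw [ENNReal.ofReal_add (hf0 x) (by positivity), ENNReal.ofReal_mul hε.le,
            ENNReal.ofReal_add (norm_nonneg _) hη.le, ofReal_norm]
        · simp [hF, hx]
      refine (lintegral_mono h3).trans (le_of_eq ?_)
      rw [lintegral_add_left hf.continuous.measurable.ennreal_ofReal,
        lintegral_const_mul' _ _ ENNReal.ofReal_ne_top,
        lintegral_add_left hfd.measurable.enorm, lintegral_indicator_const hKm]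
    have hffin : ∫⁻ x, ENNReal.ofReal (f x) ≠ ⊤ :=
      ((hf.continuous.integrable_of_hasCompactSupport hfc).lintegral_lt_top).ne
    exact (ENNReal.mul_le_mul_iff_right (by simpa using hε) ENNReal.ofReal_ne_top).1
      ((ENNReal.add_le_add_iff_left hffin).1 (h1.trans h2))
  refine ENNReal.le_of_forall_pos_le_add fun η hη _ => ?_
  have hk : 0 < volume.real K + 1 := by positivity
  refine (step (η / (volume.real K + 1)) (by positivity)).trans (add_le_add le_rfl ?_)
  rw [← ofReal_measureReal hK.measure_lt_top.ne, ← ENNReal.ofReal_mul (by positivity),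
    ← ENNReal.ofReal_coe_nnreal]
  refine ENNReal.ofReal_le_ofReal ?_
  rw [div_mul_eq_mul_div, div_le_iff₀ hk]
  have : (0 : ℝ) ≤ η := η.2
  nlinarith

/-! ### Test fields, divergence and total variation. -/

/-- The vector fields that are admissible in the definition of the perimeter. -/
structure IsTestField {d : ℕ} (φ : Space d → Space d) : Prop where
  contDiff : ContDiff ℝ 1 φ
  hasCompactSupport : HasCompactSupport φ
  norm_le_one : ∀ x, ‖φ x‖ ≤ 1

theorem fderiv_coord {d : ℕ} {φ : Space d → Space d} (hφ : ContDiff ℝ 1 φ) (x v : Space d)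
    (i : Fin d) : (fderiv ℝ φ x v) i = fderiv ℝ (fun y => φ y i) x v := by
  have h := ((EuclideanSpace.proj (𝕜 := ℝ) i).hasFDerivAt.comp x
    ((hφ.differentiable one_ne_zero) x).hasFDerivAt).fderiv
  have h2 : fderiv ℝ (fun y => φ y i) x = (EuclideanSpace.proj (𝕜 := ℝ) i).comp (fderiv ℝ φ x) := h
  rw [h2]
  rfl

theorem continuous_divergence {d : ℕ} {φ : Space d → Space d} (hφ : ContDiff ℝ 1 φ) :
    Continuous (divergence φ) := by
  have := hφ.continuous_fderiv one_ne_zero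
  unfold divergence
  fun_prop

theorem hasCompactSupport_divergence {d : ℕ} {φ : Space d → Space d}
    (hφ : HasCompactSupport φ) : HasCompactSupport (divergence φ) := by
  refine (hφ.fderiv ℝ).mono fun x hx => ?_
  contrapose! hx
  simp only [Function.mem_support, not_not] at hx ⊢
  simp [divergence, hx]

theorem integrable_divergence {d : ℕ} {φ : Space d → Space d} (hφ : ContDiff ℝ 1 φ)
    (hc : HasCompactSupport φ) : Integrable (divergence φ) :=
  (continuous_divergence hφ).integrable_of_hasCompactSupport (hasCompactSupport_divergence hc)

theorem integral_divergence_eq_zero {d : ℕ} {φ : Space d → Space d} (hφ : ContDiff ℝ 1 φ)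
    (hc : HasCompactSupport φ) : ∫ x, divergence φ x = 0 := by
  have hci : ∀ i : Fin d, ContDiff ℝ 1 fun y => φ y i := fun i =>
    (EuclideanSpace.proj (𝕜 := ℝ) i).contDiff.comp hφ
  have hsi : ∀ i : Fin d, HasCompactSupport fun y => φ y i := fun i =>
    hc.comp_left (g := fun v : Space d => v i) rfl
  have hint : ∀ (i : Fin d) (v : Space d), Integrable fun x => fderiv ℝ (fun y => φ y i) x v := by
    intro i v
    refine Continuous.integrable_of_hasCompactSupport ?_ ((hsi i).fderiv_apply ℝ v)
    exact ((hci i).continuous_fderiv one_ne_zero).clm_apply continuous_const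
  simp only [divergence, fderiv_coord hφ]
  rw [integral_finsetSum _ fun i _ => hint i _]
  refine Finset.sum_eq_zero fun i _ => ?_
  have h := integral_mul_fderiv_eq_neg_fderiv_mul_of_integrable (μ := (volume : Measure (Space d)))
    (f := fun _ => (1 : ℝ)) (g := fun y => φ y i) (v := EuclideanSpace.single i 1) (by simp)
    (by simpa using hint i _)
    (by simpa using (hci i).continuous.integrable_of_hasCompactSupport (hsi i))
    (fun x _ => by fun_prop) (fun x _ => (hci i).differentiable one_ne_zero x)
  simpa using h

theorem divergence_smul {d : ℕ} {η : Space d → ℝ} {φ : Space d → Space d} (hη : ContDiff ℝ 1 η)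
    (hφ : ContDiff ℝ 1 φ) (x : Space d) :
    divergence (fun y => η y • φ y) x = η x * divergence φ x + fderiv ℝ η x (φ x) := by
  have h1 := fderiv_fun_smul (hη.differentiable one_ne_zero x) (hφ.differentiable one_ne_zero x)
  have h2 : fderiv ℝ η x (φ x) =
      ∑ i : Fin d, fderiv ℝ η x (EuclideanSpace.single i 1) * φ x i := by
    conv_lhs => rw [← (EuclideanSpace.basisFun (Fin d) ℝ).sum_repr (φ x)]
    rw [map_sum]
    refine Finset.sum_congr rfl fun i _ => ?_
    simp [mul_comm]
  rw [h2, divergence, divergence, h1, Finset.mul_sum, ← Finset.sum_add_distrib]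
  refine Finset.sum_congr rfl fun i _ => ?_
  simp

theorem hasCompactSupport_fun_smul_left {d : ℕ} {φ : Space d → Space d}
    (hφ : HasCompactSupport φ) (η : Space d → ℝ) : HasCompactSupport fun x => η x • φ x := by
  refine hφ.mono fun x hx => ?_
  contrapose! hx
  simp only [Function.mem_support, not_not] at hx ⊢
  simp [hx]

theorem hasCompactSupport_fun_smul_right {d : ℕ} {η : Space d → ℝ}
    (hη : HasCompactSupport η) (φ : Space d → Space d) : HasCompactSupport fun x => η x • φ x := by
  refine hη.mono fun x hx => ?_
  contrapose! hx
  simp only [Function.mem_support, not_not] at hx ⊢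
  simp [hx]

theorem IsTestField.smul {d : ℕ} {η : Space d → ℝ} {φ : Space d → Space d} (hφ : IsTestField φ)
    (hη : ContDiff ℝ 1 η) (h : ∀ x, |η x| ≤ 1) : IsTestField fun x => η x • φ x where
  contDiff := hη.smul hφ.contDiff
  hasCompactSupport := hasCompactSupport_fun_smul_left hφ.hasCompactSupport η
  norm_le_one x := by
    rw [norm_smul]
    exact mul_le_one₀ (h x) (norm_nonneg _) (hφ.norm_le_one x)

/-- `T` bounds the total variation of `u`. -/
def VariationLE {d : ℕ} (u : Space d → ℝ) (T : ℝ) : Prop :=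
  ∀ φ : Space d → Space d, IsTestField φ → ∫ x, u x * divergence φ x ≤ T

theorem integrable_mul_divergence {d : ℕ} {u : Space d → ℝ} (hu : Integrable u)
    {φ : Space d → Space d} (hφ : IsTestField φ) : Integrable fun x => u x * divergence φ x := by
  obtain ⟨C, hC⟩ := (hasCompactSupport_divergence hφ.hasCompactSupport).exists_bound_of_continuous
    (continuous_divergence hφ.contDiff)
  exact hu.mul_bdd (continuous_divergence hφ.contDiff).aestronglyMeasurable
    (Filter.Eventually.of_forall hC)

theorem integrable_mul_fderiv_apply {d : ℕ} {u : Space d → ℝ} (hu : Integrable u)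
    {φ : Space d → Space d} (hφ : IsTestField φ) {η : Space d → ℝ} (hη : ContDiff ℝ 1 η) :
    Integrable fun x => u x * fderiv ℝ η x (φ x) := by
  have hcont : Continuous fun x => fderiv ℝ η x (φ x) :=
    (hη.continuous_fderiv one_ne_zero).clm_apply hφ.contDiff.continuous
  have hcs : HasCompactSupport fun x => fderiv ℝ η x (φ x) := by
    refine hφ.hasCompactSupport.mono fun x hx => ?_
    contrapose! hx
    simp only [Function.mem_support, not_not] at hx ⊢
    simp [hx]
  obtain ⟨C, hC⟩ := hcs.exists_bound_of_continuous hcont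
  exact hu.mul_bdd hcont.aestronglyMeasurable (Filter.Eventually.of_forall hC)

theorem integral_mul_mul_divergence {d : ℕ} {u : Space d → ℝ} (hu : Integrable u)
    {φ : Space d → Space d} (hφ : IsTestField φ) {η : Space d → ℝ} (hη : ContDiff ℝ 1 η)
    (h : ∀ x, |η x| ≤ 1) :
    ∫ x, u x * η x * divergence φ x = (∫ x, u x * divergence (fun y => η y • φ y) x) -
      ∫ x, u x * fderiv ℝ η x (φ x) := by
  rw [← integral_sub (integrable_mul_divergence hu (hφ.smul hη h))
    (integrable_mul_fderiv_apply hu hφ hη)]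
  refine integral_congr_ae (Filter.Eventually.of_forall fun x => ?_)
  simp only [divergence_smul hη hφ.contDiff]
  ring

/-- Smooth functions of compact support whose total variation is bounded by `T` have gradients
of integral at most `T`. -/
theorem lintegral_fderiv_le_of_variationLE {d : ℕ} {f : Space d → ℝ} (hf : ContDiff ℝ 2 f)
    (hc : HasCompactSupport f) {T : ℝ} (hT : VariationLE f T) :
    ∫⁻ x, ‖fderiv ℝ f x‖ₑ ≤ ENNReal.ofReal T := by
  have hf1 : ContDiff ℝ 1 f := hf.of_le (by norm_num)
  have hdc : Continuous (fderiv ℝ f) := hf1.continuous_fderiv one_ne_zero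
  have hdi : Integrable (fderiv ℝ f) := hdc.integrable_of_hasCompactSupport (hc.fderiv ℝ)
  set g : Space d → Space d := fun x => (InnerProductSpace.toDual ℝ (Space d)).symm (fderiv ℝ f x)
    with hg
  have hgn : ∀ x, ‖g x‖ = ‖fderiv ℝ f x‖ := fun x => LinearIsometryEquiv.norm_map _ _
  have hgf : ∀ x, fderiv ℝ f x (g x) = ‖g x‖ ^ 2 := fun x => by
    rw [← real_inner_self_eq_norm_sq]
    exact InnerProductSpace.toDual_symm_apply.symm
  have hgd : ContDiff ℝ 1 g :=
    (InnerProductSpace.toDual ℝ (Space d)).symm.contDiff.comp (hf.fderiv_right (by norm_num))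
  set K := tsupport f with hK
  have hKm : MeasurableSet K := (isClosed_tsupport f).measurableSet
  have hKfin : volume K ≠ ⊤ := hc.isCompact.measure_lt_top.ne
  have step : ∀ δ : ℝ, 0 < δ → ∫ x, ‖fderiv ℝ f x‖ ≤ T + δ * volume.real K := by
    intro δ hδ
    -- The ideal test field `-∇f / |∇f|` is singular where the gradient vanishes. Replacing `|∇f|`
    -- by `s` makes it `C¹`, at a cost of at most `δ` per point of `K`: `|∇f| - δ ≤ |∇f|² / s`.
    set s : Space d → ℝ := fun x => Real.sqrt (‖g x‖ ^ 2 + δ ^ 2) with hs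
    have hspos : ∀ x, 0 < s x := fun x => Real.sqrt_pos.2 (by positivity)
    have hsd : ContDiff ℝ 1 s := by
      refine ContDiff.sqrt ?_ fun x => by positivity
      exact (hgd.norm_sq ℝ).add contDiff_const
    have hsq : ∀ x, s x ^ 2 = ‖g x‖ ^ 2 + δ ^ 2 := fun x => Real.sq_sqrt (by positivity)
    have hφ : IsTestField fun x => (-(s x)⁻¹) • g x := by
      refine ⟨(hsd.inv fun x => (hspos x).ne').neg.smul hgd, ?_, fun x => ?_⟩
      · refine hasCompactSupport_fun_smul_left ?_ _
        exact (hc.fderiv ℝ).comp_left (g := (InnerProductSpace.toDual ℝ (Space d)).symm)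
          (map_zero _)
      · rw [norm_smul, norm_neg, norm_inv, Real.norm_of_nonneg (hspos x).le, inv_mul_le_iff₀
          (hspos x), mul_one]
        exact Real.le_sqrt_of_sq_le (by nlinarith [sq_nonneg δ])
    have h0 : ∫ x, (f x * divergence (fun x => (-(s x)⁻¹) • g x) x +
        fderiv ℝ f x ((-(s x)⁻¹) • g x)) = 0 := by
      rw [← integral_divergence_eq_zero (hf1.smul hφ.contDiff) (hasCompactSupport_fun_smul_right hc _)]
      exact integral_congr_ae (Filter.Eventually.of_forall fun x =>
        (divergence_smul hf1 hφ.contDiff x).symm)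
    have hfi : Integrable f := hf.continuous.integrable_of_hasCompactSupport hc
    have i2 : Integrable fun x => fderiv ℝ f x ((-(s x)⁻¹) • g x) := by
      refine Continuous.integrable_of_hasCompactSupport
        (hdc.clm_apply hφ.contDiff.continuous) ((hc.fderiv ℝ).mono fun x hx => ?_)
      contrapose! hx
      simp only [Function.mem_support, not_not] at hx ⊢
      simp [hx]
    rw [integral_add (integrable_mul_divergence hfi hφ) i2] at h0
    have i3 : Integrable fun x => -fderiv ℝ f x ((-(s x)⁻¹) • g x) := i2.neg
    have h1 := hT _ hφ
    have h2 : ∫ x, ‖fderiv ℝ f x‖ ≤ ∫ x, (-fderiv ℝ f x ((-(s x)⁻¹) • g x) +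
        K.indicator (fun _ => δ) x) := by
      refine integral_mono hdi.norm (i3.add
        ((integrable_indicator_iff hKm).2 (integrableOn_const hKfin))) fun x => ?_
      simp only [map_smul, hgf, smul_eq_mul, neg_mul, neg_neg]
      by_cases hx : x ∈ K
      · rw [indicator_of_mem hx, ← hgn, ← sub_le_iff_le_add, inv_mul_eq_div, le_div_iff₀ (hspos x)]
        have h3 : ‖g x‖ ≤ s x := Real.le_sqrt_of_sq_le (by nlinarith [sq_nonneg δ])
        have h4 : δ ≤ s x := Real.le_sqrt_of_sq_le (by nlinarith [sq_nonneg ‖g x‖])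
        have h5 := hsq x
        have h6 : s x ≤ ‖g x‖ + δ := by
          refine Real.sqrt_le_iff.2 ⟨by positivity, ?_⟩
          nlinarith [norm_nonneg (g x)]
        nlinarith [norm_nonneg (g x)]
      · have : fderiv ℝ f x = 0 := by
          by_contra hne
          exact hx (support_fderiv_subset ℝ hne)
        simp [hx, this, hgn]
    rw [integral_add i3 ((integrable_indicator_iff hKm).2 (integrableOn_const hKfin)),
      integral_neg, integral_indicator_const _ hKm, smul_eq_mul] at h2
    linarith
  have h1 : ∫ x, ‖fderiv ℝ f x‖ ≤ T := by
    refine le_of_forall_pos_le_add fun ε hε => ?_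
    have hk : 0 < volume.real K + 1 := by positivity
    refine (step (ε / (volume.real K + 1)) (by positivity)).trans ?_
    gcongr
    rw [div_mul_eq_mul_div, div_le_iff₀ hk]
    nlinarith
  calc ∫⁻ x, ‖fderiv ℝ f x‖ₑ = ENNReal.ofReal (∫ x, ‖fderiv ℝ f x‖) :=
        (ofReal_integral_norm_eq_lintegral_enorm hdi).symm
    _ ≤ ENNReal.ofReal T := ENNReal.ofReal_le_ofReal h1

/-! ### Smooth radial cutoff functions. -/

theorem deriv_smoothTransition_nonneg (x : ℝ) : 0 ≤ deriv Real.smoothTransition x :=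
  Real.smoothTransition.monotone.deriv_nonneg

theorem deriv_smoothTransition_of_nonpos {x : ℝ} (hx : x ≤ 0) :
    deriv Real.smoothTransition x = 0 := by
  refine IsLocalMin.deriv_eq_zero (Filter.Eventually.of_forall fun y => ?_)
  rw [Real.smoothTransition.zero_of_nonpos hx]
  exact Real.smoothTransition.nonneg y

theorem deriv_smoothTransition_of_one_le {x : ℝ} (hx : 1 ≤ x) :
    deriv Real.smoothTransition x = 0 := by
  refine IsLocalMax.deriv_eq_zero (Filter.Eventually.of_forall fun y => ?_)
  rw [Real.smoothTransition.one_of_one_le hx]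
  exact Real.smoothTransition.le_one y

theorem exists_deriv_smoothTransition_le :
    ∃ C : ℝ, 0 < C ∧ ∀ x, deriv Real.smoothTransition x ≤ C := by
  have hc : Continuous (deriv Real.smoothTransition) :=
    (Real.smoothTransition.contDiff (n := 1)).continuous_deriv le_rfl
  obtain ⟨C, hC⟩ := (isCompact_Icc (a := (0 : ℝ)) (b := 1)).exists_bound_of_continuousOn
    hc.continuousOn
  refine ⟨max C 1, by positivity, fun x => ?_⟩
  by_cases h0 : x ≤ 0
  · rw [deriv_smoothTransition_of_nonpos h0]; positivity
  by_cases h1 : 1 ≤ x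
  · rw [deriv_smoothTransition_of_one_le h1]; positivity
  · exact (le_abs_self _).trans ((hC x ⟨(not_le.1 h0).le, (not_le.1 h1).le⟩).trans (le_max_left _ _))

/-- A smooth radial function that is `1` on the ball of radius `r` and `0` outside that of
radius `R`. -/
def radialCutoff {d : ℕ} (r R : ℝ) (x : Space d) : ℝ :=
  Real.smoothTransition ((R ^ 2 - ‖x‖ ^ 2) / (R ^ 2 - r ^ 2))

section radialCutoff

variable {d : ℕ} {r R : ℝ}

/-- The cutoff is a function of the squared norm, which is smooth at the origin too. -/
theorem contDiff_radialCutoff {n : ℕ∞} : ContDiff ℝ n (radialCutoff (d := d) r R) :=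
  Real.smoothTransition.contDiff.comp
    ((contDiff_const.sub (contDiff_norm_sq ℝ)).div_const _)

theorem radialCutoff_nonneg (x : Space d) : 0 ≤ radialCutoff r R x :=
  Real.smoothTransition.nonneg _

theorem radialCutoff_le_one (x : Space d) : radialCutoff r R x ≤ 1 :=
  Real.smoothTransition.le_one _

theorem radialCutoff_eq_one (hr : 0 ≤ r) (hrR : r < R) {x : Space d} (hx : ‖x‖ ≤ r) :
    radialCutoff r R x = 1 := by
  refine Real.smoothTransition.one_of_one_le ?_
  rw [one_le_div (by nlinarith)]
  nlinarith [norm_nonneg x]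

theorem radialCutoff_eq_zero (hr : 0 ≤ r) (hrR : r < R) {x : Space d} (hx : R ≤ ‖x‖) :
    radialCutoff r R x = 0 := by
  refine Real.smoothTransition.zero_of_nonpos ?_
  exact div_nonpos_of_nonpos_of_nonneg (by nlinarith [norm_nonneg x]) (by nlinarith)

theorem hasCompactSupport_radialCutoff (hr : 0 ≤ r) (hrR : r < R) :
    HasCompactSupport (radialCutoff (d := d) r R) := by
  refine HasCompactSupport.intro (isCompact_closedBall (0 : Space d) R) fun x hx => ?_
  rw [mem_closedBall_zero_iff, not_le] at hx
  exact radialCutoff_eq_zero hr hrR hx.le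

theorem fderiv_radialCutoff_apply (x v : Space d) :
    fderiv ℝ (radialCutoff r R) x v = -(deriv Real.smoothTransition
      ((R ^ 2 - ‖x‖ ^ 2) / (R ^ 2 - r ^ 2)) * (2 * inner ℝ x v / (R ^ 2 - r ^ 2))) := by
  have h1 : HasFDerivAt (fun y : Space d => (R ^ 2 - ‖y‖ ^ 2) / (R ^ 2 - r ^ 2))
      ((R ^ 2 - r ^ 2)⁻¹ • (-((2 : ℝ) • innerSL ℝ x))) x := by
    have := ((hasStrictFDerivAt_norm_sq x).hasFDerivAt.const_sub (R ^ 2)).mul_const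
      (R ^ 2 - r ^ 2)⁻¹
    rw [← Nat.cast_smul_eq_nsmul ℝ] at this
    simpa [div_eq_mul_inv] using this
  have h2 := ((Real.smoothTransition.contDiff (n := 1)).differentiable one_ne_zero
    ((R ^ 2 - ‖x‖ ^ 2) / (R ^ 2 - r ^ 2))).hasDerivAt.comp_hasFDerivAt x h1
  have h3 : fderiv ℝ (radialCutoff r R) x = _ := h2.fderiv
  rw [h3]
  simp only [smul_neg, neg_apply, smul_apply, innerSL_apply_apply, smul_eq_mul]
  ring

theorem norm_fderiv_radialCutoff_le (hr : 0 ≤ r) (hrR : r < R) (x : Space d) :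
    ‖fderiv ℝ (radialCutoff r R) x‖ ≤ deriv Real.smoothTransition
      ((R ^ 2 - ‖x‖ ^ 2) / (R ^ 2 - r ^ 2)) * (2 * ‖x‖ / (R ^ 2 - r ^ 2)) := by
  have hp : 0 < R ^ 2 - r ^ 2 := by nlinarith
  have hs := deriv_smoothTransition_nonneg ((R ^ 2 - ‖x‖ ^ 2) / (R ^ 2 - r ^ 2))
  refine ContinuousLinearMap.opNorm_le_bound _ (by positivity) fun v => ?_
  rw [fderiv_radialCutoff_apply, norm_neg, norm_mul, Real.norm_of_nonneg hs, norm_div, norm_mul,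
    Real.norm_of_nonneg hp.le, Real.norm_two, mul_assoc, div_mul_eq_mul_div, mul_assoc 2]
  gcongr
  exact norm_inner_le_norm x v

theorem fderiv_radialCutoff_eq_zero_of_norm_le (hr : 0 ≤ r) (hrR : r < R) {x : Space d}
    (hx : ‖x‖ ≤ r) : fderiv ℝ (radialCutoff r R) x = 0 := by
  have h := norm_fderiv_radialCutoff_le hr hrR x
  rw [deriv_smoothTransition_of_one_le, zero_mul] at h
  · exact norm_le_zero_iff.1 h
  · rw [one_le_div (by nlinarith)]
    nlinarith [norm_nonneg x]

theorem fderiv_radialCutoff_eq_zero_of_le_norm (hr : 0 ≤ r) (hrR : r < R) {x : Space d}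
    (hx : R ≤ ‖x‖) : fderiv ℝ (radialCutoff r R) x = 0 := by
  have h := norm_fderiv_radialCutoff_le hr hrR x
  rw [deriv_smoothTransition_of_nonpos, zero_mul] at h
  · exact norm_le_zero_iff.1 h
  · exact div_nonpos_of_nonpos_of_nonneg (by nlinarith [norm_nonneg x]) (by nlinarith)

end radialCutoff

/-- Inside the ball of radius `R` one has `2‖x‖ / (R² - r²) ≤ 2 / (R - r)`, and outside it the
gradient vanishes; hence the factor 2 in the constant. -/
theorem exists_norm_fderiv_radialCutoff_le :
    ∃ C : ℝ, 0 < C ∧ ∀ (d : ℕ) (r R : ℝ), 0 ≤ r → r < R → ∀ x : Space d,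
      ‖fderiv ℝ (radialCutoff r R) x‖ ≤ C / (R - r) := by
  obtain ⟨C, hC, hCd⟩ := exists_deriv_smoothTransition_le
  refine ⟨C * 2, by positivity, fun d r R hr hrR x => ?_⟩
  have hp : 0 < R ^ 2 - r ^ 2 := by nlinarith
  have hq : 0 < R - r := by linarith
  by_cases hx : R ≤ ‖x‖
  · rw [fderiv_radialCutoff_eq_zero_of_le_norm hr hrR hx, norm_zero]
    positivity
  · refine (norm_fderiv_radialCutoff_le hr hrR x).trans ?_
    rw [mul_div_assoc C]
    refine mul_le_mul (hCd _) ?_ (by positivity) hC.le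
    rw [div_le_div_iff₀ hp hq]
    nlinarith [norm_nonneg x, not_le.1 hx, mul_pos hq hq]

/-- The gradient of the cutoff function has integral at most the area of the sphere of
radius `R`. -/
theorem integral_norm_fderiv_radialCutoff_le {d : ℕ} (hd : 2 ≤ d) {r R : ℝ} (hr : 0 ≤ r)
    (hrR : r < R) : ∫ x : Space d, ‖fderiv ℝ (radialCutoff r R) x‖ ≤
      d * volume.real (Metric.ball (0 : Space d) 1) * R ^ (d - 1) := by
  have hp : 0 < R ^ 2 - r ^ 2 := by nlinarith
  have hR : 0 ≤ R := by linarith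
  set F : ℝ → ℝ := fun y => deriv Real.smoothTransition
      ((R ^ 2 - y ^ 2) / (R ^ 2 - r ^ 2)) * (2 * y / (R ^ 2 - r ^ 2)) with hF
  have hdc : Continuous (deriv Real.smoothTransition) :=
    (Real.smoothTransition.contDiff (n := 1)).continuous_deriv le_rfl
  have hFc : Continuous F := by
    simp only [hF]
    fun_prop
  have hF0 : ∀ y, R ≤ y → F y = 0 := fun y hy => by
    simp only [hF]
    rw [deriv_smoothTransition_of_nonpos, zero_mul]
    exact div_nonpos_of_nonpos_of_nonneg (by nlinarith) hp.le
  have hFn : ∀ y, 0 ≤ y → 0 ≤ F y := fun y hy =>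
    mul_nonneg (deriv_smoothTransition_nonneg _) (by positivity)
  have hFx : Integrable fun x : Space d => F ‖x‖ := by
    refine (hFc.comp continuous_norm).integrable_of_hasCompactSupport ?_
    refine HasCompactSupport.intro (isCompact_closedBall (0 : Space d) R) fun x hx => ?_
    rw [mem_closedBall_zero_iff, not_le] at hx
    exact hF0 _ hx.le
  have h1 : ∫ x : Space d, ‖fderiv ℝ (radialCutoff r R) x‖ ≤ ∫ x : Space d, F ‖x‖ := by
    refine integral_mono_of_nonneg (Filter.Eventually.of_forall fun x => norm_nonneg _) hFx
      (Filter.Eventually.of_forall fun x => norm_fderiv_radialCutoff_le hr hrR x)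
  refine h1.trans ?_
  have : NeZero d := ⟨by omega⟩
  rw [integral_fun_norm_addHaar, finrank_euclideanSpace_fin, nsmul_eq_mul, smul_eq_mul, ← mul_assoc]
  refine mul_le_mul_of_nonneg_left ?_ (by positivity)
  -- `F` is the derivative of minus the radial profile, so its integral over `[0, R]` is at most 1,
  -- and the polar weight `y^(d-1)` is at most `R^(d-1)` there.
  have hG : ∀ y, HasDerivAt (fun y => -Real.smoothTransition ((R ^ 2 - y ^ 2) / (R ^ 2 - r ^ 2)))
      (F y) y := by
    intro y
    have h2 : HasDerivAt (fun y : ℝ => (R ^ 2 - y ^ 2) / (R ^ 2 - r ^ 2))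
        (-(2 * y) / (R ^ 2 - r ^ 2)) y := by
      simpa using ((hasDerivAt_pow 2 y).const_sub (R ^ 2)).div_const (R ^ 2 - r ^ 2)
    have h3 := (((Real.smoothTransition.contDiff (n := 1)).differentiable one_ne_zero
      ((R ^ 2 - y ^ 2) / (R ^ 2 - r ^ 2))).hasDerivAt.comp y h2).neg
    rw [neg_div, mul_neg, neg_neg] at h3
    exact h3
  have hint : ∫ y in (0 : ℝ)..R, F y ≤ 1 := by
    rw [intervalIntegral.integral_eq_sub_of_hasDerivAt (fun y _ => hG y)
      (hFc.intervalIntegrable _ _)]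
    have := Real.smoothTransition.le_one ((R ^ 2 - 0 ^ 2) / (R ^ 2 - r ^ 2))
    have h4 := Real.smoothTransition.zero_of_nonpos (x := (R ^ 2 - R ^ 2) / (R ^ 2 - r ^ 2))
      (by simp)
    rw [h4]
    linarith
  have hsupp : ∫ y in Ioi (0 : ℝ), y ^ (d - 1) • F y = ∫ y in (0 : ℝ)..R, y ^ (d - 1) * F y := by
    rw [intervalIntegral.integral_of_le hR]
    refine setIntegral_eq_of_subset_of_forall_sdiff_eq_zero measurableSet_Ioi
      Ioc_subset_Ioi_self fun y hy => ?_
    have : R ≤ y := by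
      by_contra h
      exact hy.2 ⟨hy.1, (not_le.1 h).le⟩
    simp [hF0 y this]
  rw [hsupp]
  calc ∫ y in (0 : ℝ)..R, y ^ (d - 1) * F y ≤ ∫ y in (0 : ℝ)..R, R ^ (d - 1) * F y := by
        refine intervalIntegral.integral_mono_on hR
          (((continuous_pow _).mul hFc).intervalIntegrable _ _)
          ((continuous_const.mul hFc).intervalIntegrable _ _) fun y hy => ?_
        exact mul_le_mul_of_nonneg_right (pow_le_pow_left₀ hy.1 hy.2 _) (hFn y hy.1)
    _ ≤ R ^ (d - 1) := by
        rw [intervalIntegral.integral_const_mul]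
        exact mul_le_of_le_one_right (by positivity) hint

/-- Integration by parts moves the derivative onto the cutoff, leaving at most the integral of the
norm of its gradient. -/
theorem integral_radialCutoff_mul_divergence_le {d : ℕ} (hd : 2 ≤ d) {r R : ℝ} (hr : 0 ≤ r)
    (hrR : r < R) {φ : Space d → Space d} (hφ : IsTestField φ) :
    ∫ x, radialCutoff r R x * divergence φ x ≤
      d * volume.real (Metric.ball (0 : Space d) 1) * R ^ (d - 1) := by
  have hη : ContDiff ℝ 1 (radialCutoff (d := d) r R) := contDiff_radialCutoff (n := 1)
  have hc := hasCompactSupport_radialCutoff (d := d) hr hrR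
  have hdc : Continuous (fderiv ℝ (radialCutoff (d := d) r R)) := hη.continuous_fderiv one_ne_zero
  have hcd : Continuous fun x => fderiv ℝ (radialCutoff r R) x (φ x) :=
    hdc.clm_apply hφ.contDiff.continuous
  have i1 : Integrable fun x => fderiv ℝ (radialCutoff r R) x (φ x) := by
    refine hcd.integrable_of_hasCompactSupport (hφ.hasCompactSupport.mono fun x hx => ?_)
    contrapose! hx
    simp only [Function.mem_support, not_not] at hx ⊢
    simp [hx]
  have i0 : Integrable fun x => radialCutoff r R x * divergence φ x :=
    integrable_mul_divergence (hη.continuous.integrable_of_hasCompactSupport hc) hφ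
  have h0 := integral_divergence_eq_zero (hη.smul hφ.contDiff)
    (hasCompactSupport_fun_smul_right hc φ)
  have h1 : ∫ x, (radialCutoff r R x * divergence φ x + fderiv ℝ (radialCutoff r R) x (φ x)) = 0 :=
    (integral_congr_ae (Filter.Eventually.of_forall fun x =>
      (divergence_smul hη hφ.contDiff x).symm)).trans h0
  rw [integral_add i0 i1] at h1
  have h2 : -∫ x, fderiv ℝ (radialCutoff r R) x (φ x) ≤
      ∫ x, ‖fderiv ℝ (radialCutoff (d := d) r R) x‖ := by
    rw [← integral_neg]
    refine integral_mono i1.neg (hdc.integrable_of_hasCompactSupport (hc.fderiv ℝ)).norm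
      fun x => ?_
    refine (neg_le_abs _).trans (((fderiv ℝ (radialCutoff r R) x).le_opNorm (φ x)).trans ?_)
    exact mul_le_of_le_one_right (norm_nonneg _) (hφ.norm_le_one x)
  linarith [integral_norm_fderiv_radialCutoff_le (d := d) hd hr hrR]

/-! ### Upper bound for the perimeter of a centred ball. -/

theorem perimeter_le_iff {d : ℕ} {E : Set (Space d)} {T : ℝ} (hT : 0 ≤ T) :
    perimeter E ≤ ENNReal.ofReal T ↔ ∀ φ, IsTestField φ → ∫ x in E, divergence φ x ≤ T := by
  simp only [perimeter, iSup_le_iff]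
  constructor
  · intro h φ hφ
    exact (ENNReal.ofReal_le_ofReal_iff hT).1 (h φ hφ.contDiff hφ.hasCompactSupport hφ.norm_le_one)
  · intro h φ h1 h2 h3
    exact ENNReal.ofReal_le_ofReal (h φ ⟨h1, h2, h3⟩)

/-- Cutoffs between the radii `r` and `r + 1/(n+1)` converge pointwise to the indicator of the
closed ball, and their variation bounds pass to the limit. -/
theorem perimeter_closedBall_zero_le {d : ℕ} (hd : 2 ≤ d) {r : ℝ} (hr : 0 ≤ r) :
    perimeter (Metric.closedBall (0 : Space d) r) ≤
      ENNReal.ofReal (d * volume.real (Metric.ball (0 : Space d) 1) * r ^ (d - 1)) := by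
  rw [perimeter_le_iff (by positivity)]
  intro φ hφ
  have hR : ∀ n : ℕ, r < r + 1 / ((n : ℝ) + 1) := fun n => by
    have : (0 : ℝ) < 1 / ((n : ℝ) + 1) := by positivity
    linarith
  have hRlim : Filter.Tendsto (fun n : ℕ => r + 1 / ((n : ℝ) + 1)) Filter.atTop (nhds r) := by
    simpa using tendsto_const_nhds.add (tendsto_one_div_add_atTop_nhds_zero_nat (𝕜 := ℝ))
  have h1 : Filter.Tendsto (fun n : ℕ => ∫ x, radialCutoff r (r + 1 / ((n : ℝ) + 1)) x *
      divergence φ x) Filter.atTop (nhds (∫ x in Metric.closedBall (0 : Space d) r,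
        divergence φ x)) := by
    rw [← integral_indicator Metric.isClosed_closedBall.measurableSet]
    refine tendsto_integral_of_dominated_convergence (fun x => ‖divergence φ x‖) (fun n => ?_)
      (integrable_divergence hφ.contDiff hφ.hasCompactSupport).norm (fun n => ?_) ?_
    · exact ((contDiff_radialCutoff (n := 1)).continuous.mul
        (continuous_divergence hφ.contDiff)).aestronglyMeasurable
    · refine Filter.Eventually.of_forall fun x => ?_
      rw [norm_mul, Real.norm_of_nonneg (radialCutoff_nonneg x)]
      exact mul_le_of_le_one_left (norm_nonneg _) (radialCutoff_le_one x)
    · refine Filter.Eventually.of_forall fun x => ?_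
      by_cases hx : x ∈ Metric.closedBall (0 : Space d) r
      · rw [indicator_of_mem hx]
        refine tendsto_const_nhds.congr fun n => ?_
        rw [radialCutoff_eq_one hr (hR n) (mem_closedBall_zero_iff.1 hx), one_mul]
      · rw [indicator_of_notMem hx]
        rw [mem_closedBall_zero_iff, not_le] at hx
        refine tendsto_const_nhds.congr' ?_
        filter_upwards [hRlim.eventually (gt_mem_nhds hx)] with n hn
        rw [radialCutoff_eq_zero hr (hR n) hn.le, zero_mul]
  refine le_of_tendsto_of_tendsto' h1 ?_ fun n =>
    integral_radialCutoff_mul_divergence_le hd hr (hR n) hφ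
  exact tendsto_const_nhds.mul (hRlim.pow _)

/-! ### The Sobolev inequality for bounded variation and the isoperimetric inequality. -/

open scoped Convolution in
/-- Averaging over translations does not increase the total variation. -/
theorem VariationLE.convolution {d : ℕ} {u : Space d → ℝ} {T : ℝ} (hu : Integrable u)
    (hT : VariationLE u T) {ρ : Space d → ℝ} (hρi : Integrable ρ) (hρ0 : ∀ x, 0 ≤ ρ x)
    (hρ1 : ∫ x, ρ x = 1) :
    VariationLE (ρ ⋆[ContinuousLinearMap.lsmul ℝ ℝ, volume] u) T := by
  intro φ hφ
  obtain ⟨C, hC⟩ := (hasCompactSupport_divergence hφ.hasCompactSupport).exists_bound_of_continuous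
    (continuous_divergence hφ.contDiff)
  have hint : Integrable (fun p : Space d × Space d => ρ p.2 * u (p.1 - p.2) * divergence φ p.1)
      (volume.prod volume) :=
    (hρi.convolution_integrand (ContinuousLinearMap.lsmul ℝ ℝ) hu).mul_bdd
      ((continuous_divergence hφ.contDiff).comp continuous_fst).aestronglyMeasurable
      (Filter.Eventually.of_forall fun p => hC p.1)
  -- A change of variables moves the translation from `u` to the test field, and translates of test
  -- fields are test fields.
  have hshift : ∀ t, ∫ x, ρ t * u (x - t) * divergence φ x =
      ρ t * ∫ x, u x * divergence (fun y => φ (y + t)) x := by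
    intro t
    rw [← integral_const_mul, ← integral_add_right_eq_self _ t]
    refine integral_congr_ae (Filter.Eventually.of_forall fun x => ?_)
    simp only [divergence, fderiv_comp_add_right, add_sub_cancel_right, mul_assoc]
  have htest : ∀ t, IsTestField fun y => φ (y + t) := fun t =>
    ⟨hφ.contDiff.comp (contDiff_id.add contDiff_const),
      hφ.hasCompactSupport.comp_homeomorph (Homeomorph.addRight t), fun x => hφ.norm_le_one _⟩
  calc ∫ x, (ρ ⋆[ContinuousLinearMap.lsmul ℝ ℝ, volume] u) x * divergence φ x
      = ∫ x, ∫ t, ρ t * u (x - t) * divergence φ x := by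
        refine integral_congr_ae (Filter.Eventually.of_forall fun x => ?_)
        simp only [convolution_def, ContinuousLinearMap.lsmul_apply, smul_eq_mul]
        rw [integral_mul_const]
    _ = ∫ t, ∫ x, ρ t * u (x - t) * divergence φ x := integral_integral_swap hint
    _ ≤ ∫ t, ρ t * T := by
        refine integral_mono hint.integral_prod_right (hρi.mul_const T) fun t => ?_
        simp only [hshift]
        exact mul_le_mul_of_nonneg_left (hT _ (htest t)) (hρ0 t)
    _ = T := by rw [integral_mul_const, hρ1, one_mul]

theorem continuous_isoProfile (d : ℕ) : Continuous (isoProfile d) := by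
  have hfin : (d : ℝ≥0∞) * volume (Metric.ball (0 : Space d) 1) ≠ ⊤ :=
    ENNReal.mul_ne_top (ENNReal.natCast_ne_top d) (volume_unitBall_ne_top d)
  exact (ENNReal.continuous_const_mul hfin).comp (ENNReal.continuous_rpow_const.comp
    (ENNReal.continuous_div_const _ (volume_unitBall_ne_zero d)))

/-- Lower semicontinuity under almost everywhere convergence. -/
theorem lintegral_isoProfile_superlevel_le_liminf {d : ℕ} (hd : 2 ≤ d) {u : Space d → ℝ}
    {v : ℕ → Space d → ℝ} (hu : Measurable u) (hv : ∀ n, Measurable (v n))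
    (h : ∀ᵐ x, Filter.Tendsto (fun n => v n x) Filter.atTop (nhds (u x))) :
    ∫⁻ t in Ioi (0 : ℝ), isoProfile d (volume {x | t < u x}) ≤
      Filter.liminf (fun n => ∫⁻ t in Ioi (0 : ℝ), isoProfile d (volume {x | t < v n x}))
        Filter.atTop := by
  -- A strict inequality `t < u x` persists for `v n x` eventually, so Fatou's lemma applies to the
  -- indicators of the strict superlevel sets; it is used once more for the integral over `t`.
  have key : ∀ t : ℝ, volume {x | t < u x} ≤
      Filter.liminf (fun n => volume {x | t < v n x}) Filter.atTop := by
    intro t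
    have hm : ∀ w : Space d → ℝ, Measurable w → MeasurableSet {x | t < w x} := fun w hw =>
      measurableSet_lt measurable_const hw
    calc volume {x | t < u x} = ∫⁻ x, {x | t < u x}.indicator 1 x :=
          (lintegral_indicator_one (hm u hu)).symm
      _ ≤ ∫⁻ x, Filter.liminf (fun n => {x | t < v n x}.indicator (1 : Space d → ℝ≥0∞) x)
            Filter.atTop := by
          refine lintegral_mono_ae (h.mono fun x hx => ?_)
          by_cases hxt : t < u x
          · refine Filter.le_liminf_of_le (by isBoundedDefault) ?_
            filter_upwards [hx.eventually (lt_mem_nhds hxt)] with n hn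
            simp [hxt, hn]
          · simp [hxt]
      _ ≤ Filter.liminf (fun n => ∫⁻ x, {x | t < v n x}.indicator (1 : Space d → ℝ≥0∞) x)
            Filter.atTop := lintegral_liminf_le fun n => measurable_one.indicator (hm _ (hv n))
      _ = Filter.liminf (fun n => volume {x | t < v n x}) Filter.atTop := by
          simp only [lintegral_indicator_one (hm _ (hv _))]
  calc ∫⁻ t in Ioi (0 : ℝ), isoProfile d (volume {x | t < u x})
      ≤ ∫⁻ t in Ioi (0 : ℝ), Filter.liminf (fun n => isoProfile d (volume {x | t < v n x}))
          Filter.atTop := by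
        refine lintegral_mono fun t => (isoProfile_mono d hd (key t)).trans_eq ?_
        exact (isoProfile_mono d hd).map_liminf_of_continuousAt _
          (continuous_isoProfile d).continuousAt
    _ ≤ _ := lintegral_liminf_le fun n => measurable_isoProfile_superlevel hd (v n)

open scoped Convolution in
theorem lintegral_isoProfile_superlevel_le_of_hasCompactSupport {d : ℕ} (hd : 2 ≤ d)
    {u : Space d → ℝ} (hum : Measurable u) (hu : Integrable u) (hc : HasCompactSupport u)
    (hu0 : ∀ x, 0 ≤ u x) {T : ℝ} (hT : VariationLE u T) :
    ∫⁻ t in Ioi (0 : ℝ), isoProfile d (volume {x | t < u x}) ≤ ENNReal.ofReal T := by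
  -- The outer radius is a fixed multiple of the inner one, as the almost everywhere convergence of
  -- the mollifications requires (`K := 2`).
  let ρ : ℕ → ContDiffBump (0 : Space d) := fun n =>
    ⟨1 / ((n : ℝ) + 1), 2 * (1 / ((n : ℝ) + 1)), by positivity, by
      have : (0 : ℝ) < 1 / ((n : ℝ) + 1) := by positivity
      linarith⟩
  set v : ℕ → Space d → ℝ := fun n =>
    (ρ n).normed volume ⋆[ContinuousLinearMap.lsmul ℝ ℝ, volume] u with hv
  have hsmooth : ∀ n, ContDiff ℝ 2 (v n) := fun n =>
    (ρ n).hasCompactSupport_normed.contDiff_convolution_left _ ((ρ n).contDiff_normed (n := 2))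
      hu.locallyIntegrable
  have hcs : ∀ n, HasCompactSupport (v n) := fun n =>
    (ρ n).hasCompactSupport_normed.convolution _ hc
  have hlim : ∀ᵐ x, Filter.Tendsto (fun n => v n x) Filter.atTop (nhds (u x)) := by
    refine ContDiffBump.ae_convolution_tendsto_right_of_locallyIntegrable (K := 2) ?_
      (Filter.Eventually.of_forall fun n => le_rfl) hu.locallyIntegrable
    have := (tendsto_one_div_add_atTop_nhds_zero_nat (𝕜 := ℝ)).const_mul 2
    rwa [mul_zero] at this
  have hbound : ∀ n, ∫⁻ t in Ioi (0 : ℝ), isoProfile d (volume {x | t < v n x}) ≤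
      ENNReal.ofReal T := by
    intro n
    refine (lintegral_isoProfile_superlevel_le_lintegral_fderiv hd ((hsmooth n).of_le (by norm_num))
      (hcs n) fun x => ?_).trans (lintegral_fderiv_le_of_variationLE (hsmooth n) (hcs n) ?_)
    · exact integral_nonneg fun t => mul_nonneg ((ρ n).nonneg_normed t) (hu0 _)
    · exact hT.convolution hu (ρ n).integrable_normed (ρ n).nonneg_normed (ρ n).integral_normed
  refine (lintegral_isoProfile_superlevel_le_liminf hd hum
    (fun n => (hsmooth n).continuous.measurable) hlim).trans ?_
  exact (Filter.liminf_le_liminf (Filter.Eventually.of_forall hbound)).trans_eq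
    (Filter.liminf_const _)

/-- By the product rule `η div φ = div (η φ) - ∇η · φ`; here `η φ` is a test field and the last term
is at most `G` in absolute value. -/
theorem VariationLE.mul_cutoff {d : ℕ} {u : Space d → ℝ} {T : ℝ} (hu : Integrable u)
    (hu0 : ∀ x, 0 ≤ u x) (hT : VariationLE u T) {η : Space d → ℝ} (hη : ContDiff ℝ 1 η)
    (h : ∀ x, |η x| ≤ 1) {G : ℝ} (hG : ∀ x, ‖fderiv ℝ η x‖ ≤ G) :
    VariationLE (fun x => u x * η x) (T + G * ∫ x, u x) := by
  intro φ hφ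
  rw [integral_mul_mul_divergence hu hφ hη h]
  have h1 := hT _ (hφ.smul hη h)
  have h2 : -∫ x, u x * fderiv ℝ η x (φ x) ≤ G * ∫ x, u x := by
    rw [← integral_neg, ← integral_const_mul]
    refine integral_mono (integrable_mul_fderiv_apply hu hφ hη).neg (hu.const_mul G) fun x => ?_
    have h3 : -fderiv ℝ η x (φ x) ≤ G :=
      (neg_le_abs _).trans (((fderiv ℝ η x).le_opNorm (φ x)).trans
        ((mul_le_of_le_one_right (norm_nonneg _) (hφ.norm_le_one x)).trans (hG x)))
    nlinarith [hu0 x]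
  linarith

theorem abs_radialCutoff_le_one {d : ℕ} {r R : ℝ} (x : Space d) : |radialCutoff r R x| ≤ 1 :=
  abs_le.2 ⟨by linarith [radialCutoff_nonneg (r := r) (R := R) x], radialCutoff_le_one x⟩

/-- The sharp Sobolev inequality for integrable functions of bounded variation, in terms of the
volumes of the superlevel sets. -/
theorem VariationLE.lintegral_isoProfile_superlevel_le {d : ℕ} (hd : 2 ≤ d)
    {u : Space d → ℝ} (hum : Measurable u) (hu : Integrable u)
    (hu0 : ∀ x, 0 ≤ u x) {T : ℝ} (hT : VariationLE u T) :
    ∫⁻ t in Ioi (0 : ℝ), isoProfile d (volume {x | t < u x}) ≤ ENNReal.ofReal T := by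
  obtain ⟨C, hC, hCd⟩ := exists_norm_fderiv_radialCutoff_le
  -- Transition layers of width `n + 1` have gradients of size `C / (n + 1)`, so the error in the
  -- variation vanishes as `u` is integrable.
  set χ : ℕ → Space d → ℝ := fun n => radialCutoff ((n : ℝ) + 1) (2 * ((n : ℝ) + 1)) with hχ
  have hr : ∀ n : ℕ, (0 : ℝ) ≤ (n : ℝ) + 1 := fun n => by positivity
  have hrR : ∀ n : ℕ, (n : ℝ) + 1 < 2 * ((n : ℝ) + 1) := fun n => by
    have : (0 : ℝ) < (n : ℝ) + 1 := by positivity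
    linarith
  have hχd : ∀ n, ContDiff ℝ 1 (χ n) := fun n => contDiff_radialCutoff (n := 1)
  have hbound : ∀ n : ℕ, ∫⁻ t in Ioi (0 : ℝ), isoProfile d (volume {x | t < u x * χ n x}) ≤
      ENNReal.ofReal (T + C * (1 / ((n : ℝ) + 1)) * ∫ x, u x) := by
    intro n
    refine lintegral_isoProfile_superlevel_le_of_hasCompactSupport hd
      (hum.mul (hχd n).continuous.measurable) ?_ ?_
      (fun x => mul_nonneg (hu0 x) (radialCutoff_nonneg x))
      (hT.mul_cutoff hu hu0 (hχd n) abs_radialCutoff_le_one fun x => ?_)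
    · exact hu.mul_bdd (hχd n).continuous.aestronglyMeasurable
        (Filter.Eventually.of_forall fun x => abs_radialCutoff_le_one x)
    · exact (hasCompactSupport_radialCutoff (hr n) (hrR n)).mul_left
    · refine (hCd d _ _ (hr n) (hrR n) x).trans_eq ?_
      rw [two_mul, add_sub_cancel_right, mul_one_div]
  have hlim : ∀ x, Filter.Tendsto (fun n => u x * χ n x) Filter.atTop (nhds (u x)) := by
    intro x
    obtain ⟨N, hN⟩ := exists_nat_ge ‖x‖
    refine tendsto_const_nhds.congr' ?_
    filter_upwards [Filter.eventually_ge_atTop N] with n hn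
    have : (N : ℝ) ≤ n := by exact_mod_cast hn
    simp only [hχ]
    rw [radialCutoff_eq_one (hr n) (hrR n) (by linarith), mul_one]
  refine (lintegral_isoProfile_superlevel_le_liminf hd hum
    (fun n => hum.mul (hχd n).continuous.measurable) (Filter.Eventually.of_forall hlim)).trans ?_
  refine (Filter.liminf_le_liminf (Filter.Eventually.of_forall hbound)).trans_eq ?_
  refine Filter.Tendsto.liminf_eq ?_
  refine (ENNReal.continuous_ofReal.tendsto T).comp ?_
  simpa using (((tendsto_one_div_add_atTop_nhds_zero_nat (𝕜 := ℝ)).const_mul C).mul_const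
    (∫ x, u x)).const_add T

theorem variationLE_indicator {d : ℕ} {E : Set (Space d)} (hE : MeasurableSet E) {T : ℝ}
    (hT : 0 ≤ T) (h : perimeter E ≤ ENNReal.ofReal T) :
    VariationLE (E.indicator fun _ => 1) T := by
  intro φ hφ
  refine le_trans (le_of_eq ?_) ((perimeter_le_iff hT).1 h φ hφ)
  rw [← integral_indicator hE]
  refine integral_congr_ae (Filter.Eventually.of_forall fun x => ?_)
  by_cases hx : x ∈ E <;> simp [hx]

/-- `A` lies in every superlevel set of height `t < 1`, an interval of length 1. This recovers
volumes of sets from the functional inequality, for `E` and for its cut parts. -/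
theorem isoProfile_le_lintegral_superlevel {d : ℕ} (hd : 2 ≤ d) {u : Space d → ℝ}
    {A : Set (Space d)} (h : ∀ x ∈ A, 1 ≤ u x) :
    isoProfile d (volume A) ≤ ∫⁻ t in Ioi (0 : ℝ), isoProfile d (volume {x | t < u x}) := by
  calc isoProfile d (volume A) = ∫⁻ _ in Ioo (0 : ℝ) 1, isoProfile d (volume A) := by simp
    _ ≤ ∫⁻ t in Ioo (0 : ℝ) 1, isoProfile d (volume {x | t < u x}) :=
        setLIntegral_mono' measurableSet_Ioo fun t ht => isoProfile_mono d hd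
          (measure_mono fun x hx => lt_of_lt_of_le ht.2 (h x hx))
    _ ≤ _ := lintegral_mono_set Ioo_subset_Ioi_self

/-- The isoperimetric inequality. -/
theorem isoProfile_volume_le_perimeter {d : ℕ} (hd : 2 ≤ d) {E : Set (Space d)}
    (hE : MeasurableSet E) (hfin : volume E ≠ ⊤) : isoProfile d (volume E) ≤ perimeter E := by
  by_cases hP : perimeter E = ⊤
  · simp [hP]
  have hT := variationLE_indicator hE ENNReal.toReal_nonneg (ENNReal.ofReal_toReal hP).ge
  have h1 := hT.lintegral_isoProfile_superlevel_le hd (measurable_const.indicator hE)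
    ((integrable_indicator_iff hE).2 (integrableOn_const hfin))
    (fun x => indicator_nonneg (fun _ _ => zero_le_one) x)
  rw [ENNReal.ofReal_toReal hP] at h1
  exact (isoProfile_le_lintegral_superlevel hd fun x hx => by simp [hx]).trans h1

/-! ### Essential boundedness of isoperimetric sets. -/

/-- A superlinear decay estimate at all small scales forces vanishing. -/
theorem exists_eq_zero_of_rpow_le {V : ℝ → ℝ} (hanti : Antitone V) (h0 : ∀ r, 0 ≤ V r)
    (hlim : Filter.Tendsto V Filter.atTop (nhds 0)) {p A : ℝ} (hp0 : 0 < p) (hp1 : p < 1)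
    (hA : 0 < A) (h : ∀ r s, 0 ≤ r → 0 < s → s ≤ 1 → V (r + s) ^ p ≤ A / s * V r) :
    ∃ r, V r = 0 := by
  have hq : 0 < 1 - p := by linarith
  -- The ratio `θ` solves `2θ = θ^p` and the starting size `δ` below solves `2Aδ = θ^p δ^p`; these
  -- are the identities that close the induction.
  set θ : ℝ := (1 / 2 : ℝ) ^ (1 / (1 - p)) with hθ
  have hθ0 : 0 < θ := by positivity
  have hθ1 : θ < 1 := Real.rpow_lt_one (by norm_num) (by norm_num) (by positivity)
  have hθp : 2 * θ = θ ^ p := by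
    have h1 : θ ^ (1 - p) = 1 / 2 := by
      rw [hθ, ← Real.rpow_mul (by norm_num), one_div_mul_cancel hq.ne', Real.rpow_one]
    have h2 : θ = θ ^ p * θ ^ (1 - p) := by
      rw [← Real.rpow_add hθ0, add_sub_cancel, Real.rpow_one]
    rw [h1] at h2
    linarith
  set δ : ℝ := (θ ^ p / (2 * A)) ^ (1 / (1 - p)) with hδ
  have hδ0 : 0 < δ := by positivity
  have hδp : 2 * A * δ = θ ^ p * δ ^ p := by
    have h1 : δ ^ (1 - p) = θ ^ p / (2 * A) := by
      rw [hδ, ← Real.rpow_mul (by positivity), one_div_mul_cancel hq.ne', Real.rpow_one]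
    have h2 : δ = δ ^ p * δ ^ (1 - p) := by
      rw [← Real.rpow_add hδ0, add_sub_cancel, Real.rpow_one]
    conv_lhs => rw [h2, h1]
    field_simp
  obtain ⟨r₀, hr₀, hVr₀⟩ : ∃ r₀, 0 ≤ r₀ ∧ V r₀ ≤ δ := by
    obtain ⟨r, hr⟩ := ((hlim.eventually (gt_mem_nhds hδ0)).and
      (Filter.eventually_ge_atTop 0)).exists
    exact ⟨r, hr.2, hr.1.le⟩
  -- The steps `(1/2)^(k+1)` have total length 1, so all radii stay below `r₀ + 1`, where `V` is
  -- squeezed to zero by the geometric decay.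
  have key : ∀ k : ℕ, V (r₀ + (1 - (1 / 2) ^ k)) ≤ δ * θ ^ k := by
    intro k
    induction k with
    | zero => simpa using hVr₀
    | succ k ih =>
      have hk1 : (1 / 2 : ℝ) ^ k ≤ 1 := pow_le_one₀ (by norm_num) (by norm_num)
      have hk0 : (0 : ℝ) < (1 / 2) ^ k := by positivity
      have h1 := h (r₀ + (1 - (1 / 2) ^ k)) ((1 / 2) ^ (k + 1)) (by linarith) (by positivity)
        (pow_le_one₀ (by norm_num) (by norm_num))
      have e : r₀ + (1 - (1 / 2 : ℝ) ^ k) + (1 / 2) ^ (k + 1) = r₀ + (1 - (1 / 2) ^ (k + 1)) := by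
        rw [pow_succ]; ring
      rw [e] at h1
      have h2 : V (r₀ + (1 - (1 / 2) ^ (k + 1))) ^ p ≤ (δ * θ ^ (k + 1)) ^ p := by
        refine h1.trans ((mul_le_mul_of_nonneg_left ih (by positivity)).trans_eq ?_)
        have e2 : A / (1 / 2 : ℝ) ^ (k + 1) = 2 * A * 2 ^ k := by
          rw [one_div, inv_pow, div_inv_eq_mul, pow_succ]; ring
        calc A / (1 / 2 : ℝ) ^ (k + 1) * (δ * θ ^ k) = (2 * A * δ) * (2 * θ) ^ k := by
              rw [e2, mul_pow]; ring
          _ = θ ^ p * δ ^ p * (θ ^ p) ^ k := by rw [hδp, hθp]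
          _ = (δ * θ ^ (k + 1)) ^ p := by
              rw [Real.mul_rpow hδ0.le (by positivity), ← Real.rpow_natCast θ (k + 1),
                ← Real.rpow_natCast (θ ^ p), ← Real.rpow_mul hθ0.le, ← Real.rpow_mul hθ0.le,
                mul_right_comm, ← Real.rpow_add hθ0, mul_comm]
              congr 2
              push_cast
              ring
      exact (Real.rpow_le_rpow_iff (h0 _) (by positivity) hp0).1 h2
  refine ⟨r₀ + 1, le_antisymm ?_ (h0 _)⟩
  have hlim2 : Filter.Tendsto (fun k : ℕ => δ * θ ^ k) Filter.atTop (nhds 0) := by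
    simpa using (tendsto_pow_atTop_nhds_zero_of_lt_one hθ0.le hθ1).const_mul δ
  refine ge_of_tendsto' hlim2 fun k => (hanti ?_).trans (key k)
  have : (0 : ℝ) < (1 / 2) ^ k := by positivity
  linarith

theorem divergence_add {d : ℕ} {φ ψ : Space d → Space d} (hφ : ContDiff ℝ 1 φ)
    (hψ : ContDiff ℝ 1 ψ) (x : Space d) :
    divergence (fun y => φ y + ψ y) x = divergence φ x + divergence ψ x := by
  simp only [divergence]
  rw [fderiv_fun_add (hφ.differentiable one_ne_zero x) (hψ.differentiable one_ne_zero x),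
    ← Finset.sum_add_distrib]
  simp

/-- By convexity of the unit ball, two fields glue into one that tests both parts of a cut at once.
-/
theorem IsTestField.convex_combo {d : ℕ} {η : Space d → ℝ} {φ ψ : Space d → Space d}
    (hφ : IsTestField φ) (hψ : IsTestField ψ) (hη : ContDiff ℝ 1 η) (h0 : ∀ x, 0 ≤ η x)
    (h1 : ∀ x, η x ≤ 1) : IsTestField fun x => η x • φ x + (1 - η x) • ψ x where
  contDiff := (hη.smul hφ.contDiff).add ((contDiff_const.sub hη).smul hψ.contDiff)
  hasCompactSupport := (hasCompactSupport_fun_smul_left hφ.hasCompactSupport η).add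
    (hasCompactSupport_fun_smul_left hψ.hasCompactSupport fun x => 1 - η x)
  norm_le_one x := by
    refine (norm_add_le _ _).trans ?_
    rw [norm_smul, norm_smul, Real.norm_of_nonneg (h0 x),
      Real.norm_of_nonneg (by linarith [h1 x])]
    nlinarith [h0 x, h1 x, hφ.norm_le_one x, hψ.norm_le_one x]

/-- Cutting a function in two parts increases the total variation by at most the cost of
the cut. -/
theorem VariationLE.cut {d : ℕ} {u : Space d → ℝ} {T : ℝ} (hu : Integrable u)
    (hu0 : ∀ x, 0 ≤ u x) (hT : VariationLE u T) {η : Space d → ℝ} (hη : ContDiff ℝ 1 η)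
    (h0 : ∀ x, 0 ≤ η x) (h1 : ∀ x, η x ≤ 1) {G : ℝ} (hG : ∀ x, ‖fderiv ℝ η x‖ ≤ G)
    {A : Set (Space d)} (hA : MeasurableSet A) (hAη : ∀ x ∉ A, fderiv ℝ η x = 0)
    {φ ψ : Space d → Space d} (hφ : IsTestField φ) (hψ : IsTestField ψ) :
    (∫ x, u x * η x * divergence φ x) + ∫ x, u x * (1 - η x) * divergence ψ x ≤
      T + 2 * G * ∫ x in A, u x := by
  have hη' : ContDiff ℝ 1 fun x => 1 - η x := contDiff_const.sub hη
  have ha : ∀ x, |η x| ≤ 1 := fun x => abs_le.2 ⟨by linarith [h0 x], h1 x⟩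
  have ha' : ∀ x, |1 - η x| ≤ 1 := fun x => abs_le.2 ⟨by linarith [h1 x], by linarith [h0 x]⟩
  rw [integral_mul_mul_divergence hu hφ hη ha, integral_mul_mul_divergence hu hψ hη' ha']
  have i1 := integrable_mul_divergence hu (hφ.smul hη ha)
  have i2 := integrable_mul_divergence hu (hψ.smul hη' ha')
  have i3 := integrable_mul_fderiv_apply hu hφ hη
  have i4 := integrable_mul_fderiv_apply hu hψ hη'
  -- Testing with the glued field costs `T` only once for both parts; the remainder `u ∇η · (φ - ψ)`
  -- lives on `A` and is at most `2 G u`.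
  have e1 := hT _ (hφ.convex_combo hψ hη h0 h1)
  have e2 : ∫ x, u x * divergence (fun y => η y • φ y + (1 - η y) • ψ y) x =
      (∫ x, u x * divergence (fun y => η y • φ y) x) +
        ∫ x, u x * divergence (fun y => (1 - η y) • ψ y) x := by
    rw [← integral_add i1 i2]
    refine integral_congr_ae (Filter.Eventually.of_forall fun x => ?_)
    have := divergence_add (hη.smul hφ.contDiff) (hη'.smul hψ.contDiff) x
    exact (congrArg (u x * ·) this).trans (mul_add _ _ _)
  have bound : ∀ w : Space d, ‖w‖ ≤ 1 → ∀ x, |fderiv ℝ η x w| ≤ G := fun w hw x =>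
    ((fderiv ℝ η x).le_opNorm w).trans
      ((mul_le_of_le_one_right (norm_nonneg _) hw).trans (hG x))
  have e3 : -((∫ x, u x * fderiv ℝ η x (φ x)) + ∫ x, u x * fderiv ℝ (fun x => 1 - η x) x (ψ x)) ≤
      2 * G * ∫ x in A, u x := by
    rw [← integral_add i3 i4, ← integral_neg, ← integral_indicator hA, ← integral_const_mul]
    refine integral_mono (i3.add i4).neg ((hu.indicator hA).const_mul _) fun x => ?_
    simp only [fderiv_const_sub, neg_apply]
    by_cases hx : x ∈ A
    · rw [indicator_of_mem hx]
      have h2 := abs_le.1 (bound _ (hφ.norm_le_one x) x)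
      have h3 := abs_le.1 (bound _ (hψ.norm_le_one x) x)
      nlinarith [hu0 x]
    · simp [hx, hAη x hx]
  linarith

theorem isoProfile_ofReal {d : ℕ} (hd : 2 ≤ d) : ∃ c : ℝ, 0 < c ∧ ∀ v : ℝ, 0 ≤ v →
    isoProfile d (ENNReal.ofReal v) = ENNReal.ofReal (c * v ^ (((d : ℝ) - 1) / d)) := by
  set w := volume.real (Metric.ball (0 : Space d) 1) with hw
  have hw0 : 0 < w := ENNReal.toReal_pos (volume_unitBall_ne_zero d) (volume_unitBall_ne_top d)
  have hww : volume (Metric.ball (0 : Space d) 1) = ENNReal.ofReal w :=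
    (ofReal_measureReal (volume_unitBall_ne_top d)).symm
  have hd0 : (0 : ℝ) < d := by positivity
  have hd1 : (0 : ℝ) ≤ (d : ℝ) - 1 := by
    have : (2 : ℝ) ≤ d := by exact_mod_cast hd
    linarith
  refine ⟨d * w * (w ^ (((d : ℝ) - 1) / d))⁻¹, by positivity, fun v hv => ?_⟩
  rw [isoProfile, hww, ← ENNReal.ofReal_div_of_pos hw0,
    ENNReal.ofReal_rpow_of_nonneg (by positivity) (by positivity), ← ENNReal.ofReal_natCast,
    ← ENNReal.ofReal_mul (by positivity), ← ENNReal.ofReal_mul (by positivity),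
    Real.div_rpow hv hw0.le]
  congr 1
  ring

/-- The isoperimetric inequality for both parts of a set that is cut by a sphere. -/
theorem isoProfile_add_isoProfile_le {d : ℕ} (hd : 2 ≤ d) {E : Set (Space d)}
    (hE : MeasurableSet E) (hfin : volume E ≠ ⊤) {T : ℝ} (hT0 : 0 ≤ T)
    (hT : perimeter E ≤ ENNReal.ofReal T) {G r R : ℝ} (hr : 0 ≤ r) (hrR : r < R)
    (hG : ∀ x : Space d, ‖fderiv ℝ (radialCutoff r R) x‖ ≤ G) :
    isoProfile d (volume (E ∩ Metric.ball 0 r)) + isoProfile d (volume (E \ Metric.ball 0 R)) ≤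
      ENNReal.ofReal (T + 2 * G * volume.real (E \ Metric.ball 0 r)) := by
  set u : Space d → ℝ := E.indicator fun _ => 1 with hu
  have hui : Integrable u := (integrable_indicator_iff hE).2 (integrableOn_const hfin)
  have hum : Measurable u := measurable_const.indicator hE
  have hu0 : ∀ x, 0 ≤ u x := fun x => indicator_nonneg (fun _ _ => zero_le_one) x
  set η : Space d → ℝ := radialCutoff r R with hη
  have hηd : ContDiff ℝ 1 η := contDiff_radialCutoff (n := 1)
  have hA : MeasurableSet (Metric.ball (0 : Space d) r)ᶜ := Metric.isOpen_ball.measurableSet.compl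
  have hAint : ∫ x in (Metric.ball (0 : Space d) r)ᶜ, u x = volume.real (E \ Metric.ball 0 r) := by
    rw [integral_indicator_const _ hE, measureReal_restrict_apply hE, smul_eq_mul, mul_one,
      ← sdiff_eq]
  set S := T + 2 * G * volume.real (E \ Metric.ball 0 r) with hS
  have hcut : ∀ φ ψ : Space d → Space d, IsTestField φ → IsTestField ψ →
      (∫ x, u x * η x * divergence φ x) + ∫ x, u x * (1 - η x) * divergence ψ x ≤ S := by
    intro φ ψ hφ hψ
    have := (variationLE_indicator hE hT0 hT).cut hui hu0 hηd radialCutoff_nonneg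
      radialCutoff_le_one hG hA (fun x hx => fderiv_radialCutoff_eq_zero_of_norm_le hr hrR
        (by rw [mem_compl_iff, not_not, mem_ball_zero_iff] at hx; exact hx.le)) hφ hψ
    rwa [hAint] at this
  set X := ∫⁻ t in Ioi (0 : ℝ), isoProfile d (volume {x | t < u x * η x}) with hX
  set Y := ∫⁻ t in Ioi (0 : ℝ), isoProfile d (volume {x | t < u x * (1 - η x)}) with hY
  have hη1 : ∀ x, 0 ≤ 1 - η x := fun x => sub_nonneg.2 (radialCutoff_le_one x)
  have hi1 : Integrable fun x => u x * η x := hui.mul_bdd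
    hηd.continuous.aestronglyMeasurable (Filter.Eventually.of_forall abs_radialCutoff_le_one)
  have hi2 : Integrable fun x => u x * (1 - η x) := by
    refine (hui.sub hi1).congr (Filter.Eventually.of_forall fun x => ?_)
    simp only [Pi.sub_apply]
    ring
  -- For fixed `ψ` the joint bound is a variation bound for `u η`, which gives `X`. Read the other
  -- way, it bounds every integral with `ψ` by `S - X`, a variation bound for `u (1 - η)`.
  have hX1 : ∀ ψ : Space d → Space d, IsTestField ψ →
      X ≤ ENNReal.ofReal (S - ∫ x, u x * (1 - η x) * divergence ψ x) := fun ψ hψ =>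
    VariationLE.lintegral_isoProfile_superlevel_le hd (u := fun x => u x * η x)
      (hum.mul hηd.continuous.measurable) hi1 (fun x => mul_nonneg (hu0 x) (radialCutoff_nonneg x))
      fun φ hφ => by linarith [hcut φ ψ hφ hψ]
  -- The zero field shows that `X` is finite and at most `S`, and that the integrals with `ψ` do not
  -- exceed `S`, so that no truncation by `ENNReal.ofReal` interferes.
  have hzero : IsTestField fun _ : Space d => (0 : Space d) :=
    ⟨contDiff_const, HasCompactSupport.zero, fun x => by simp⟩
  have hdz : ∀ x : Space d, divergence (fun _ : Space d => (0 : Space d)) x = 0 := fun x => by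
    simp [divergence]
  have hXfin : X ≠ ⊤ := ne_top_of_le_ne_top ENNReal.ofReal_ne_top (hX1 _ hzero)
  have hnn : ∀ ψ : Space d → Space d, IsTestField ψ →
      ∫ x, u x * (1 - η x) * divergence ψ x ≤ S := fun ψ hψ => by
    simpa [hdz] using hcut _ ψ hzero hψ
  have hY1 : Y ≤ ENNReal.ofReal (S - X.toReal) := by
    refine VariationLE.lintegral_isoProfile_superlevel_le hd (u := fun x => u x * (1 - η x))
      (hum.mul (measurable_const.sub hηd.continuous.measurable)) hi2
      (fun x => mul_nonneg (hu0 x) (hη1 x)) fun ψ hψ => ?_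
    have := ENNReal.toReal_le_of_le_ofReal (by linarith [hnn ψ hψ]) (hX1 ψ hψ)
    linarith
  have hXS : X.toReal ≤ S := by
    have := ENNReal.toReal_le_of_le_ofReal (by linarith [hnn _ hzero]) (hX1 _ hzero)
    simpa [hdz] using this
  calc isoProfile d (volume (E ∩ Metric.ball 0 r)) + isoProfile d (volume (E \ Metric.ball 0 R))
      ≤ X + Y := by
        refine add_le_add (isoProfile_le_lintegral_superlevel hd fun x hx => ?_)
          (isoProfile_le_lintegral_superlevel hd fun x hx => ?_)
        · rw [hη, radialCutoff_eq_one hr hrR (mem_ball_zero_iff.1 hx.2).le]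
          simp [hu, hx.1]
        · rw [hη, radialCutoff_eq_zero hr hrR (not_lt.1 fun h => hx.2 (mem_ball_zero_iff.2 h))]
          simp [hu, hx.1]
    _ ≤ ENNReal.ofReal X.toReal + ENNReal.ofReal (S - X.toReal) :=
        add_le_add (ENNReal.ofReal_toReal hXfin).ge hY1
    _ = ENNReal.ofReal S := by
        rw [← ENNReal.ofReal_add ENNReal.toReal_nonneg (by linarith), add_sub_cancel]

/-- Isoperimetric sets are essentially bounded. -/
theorem exists_volume_diff_ball_eq_zero {d : ℕ} (hd : 2 ≤ d) {E : Set (Space d)}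
    (hE : MeasurableSet E) (hfin : volume E ≠ ⊤) (h0 : volume E ≠ 0)
    (hP : perimeter E ≤ isoProfile d (volume E)) :
    ∃ r : ℝ, volume (E \ Metric.ball 0 r) = 0 := by
  obtain ⟨c, hc, hcI⟩ := isoProfile_ofReal hd
  obtain ⟨C, hC, hCd⟩ := exists_norm_fderiv_radialCutoff_le
  set p : ℝ := ((d : ℝ) - 1) / d with hp
  have hd2 : (2 : ℝ) ≤ d := by exact_mod_cast hd
  have hp0 : 0 < p := div_pos (by linarith) (by linarith)
  have hp1 : p < 1 := (div_lt_one (by linarith)).2 (by linarith)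
  set m := volume.real E with hm
  have hm0 : 0 < m := ENNReal.toReal_pos h0 hfin
  set V : ℝ → ℝ := fun r => volume.real (E \ Metric.ball 0 r) with hV
  have hVfin : ∀ r, volume (E \ Metric.ball 0 r) ≠ ⊤ := fun r =>
    ne_top_of_le_ne_top hfin (measure_mono sdiff_subset)
  have hVm : ∀ r, V r ≤ m := fun r => measureReal_mono sdiff_subset hfin
  have hV0 : ∀ r, 0 ≤ V r := fun r => measureReal_nonneg
  have hanti : Antitone V := fun r s hrs =>
    measureReal_mono (sdiff_subset_sdiff_right (Metric.ball_subset_ball hrs)) (hVfin r)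
  have hlim : Filter.Tendsto V Filter.atTop (nhds 0) := by
    have h1 := tendsto_measure_iInter_atTop (μ := volume)
      (s := fun r : ℝ => E \ Metric.ball 0 r)
      (fun r => (hE.diff Metric.isOpen_ball.measurableSet).nullMeasurableSet)
      (fun r s hrs => sdiff_subset_sdiff_right (Metric.ball_subset_ball hrs)) ⟨0, hVfin 0⟩
    have h2 : ⋂ r : ℝ, E \ Metric.ball 0 r = ∅ := by
      refine eq_empty_of_forall_notMem fun x hx => ?_
      have := (mem_iInter.1 hx (‖x‖ + 1)).2
      simp at this
    rw [h2, measure_empty] at h1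
    exact (ENNReal.tendsto_toReal ENNReal.zero_ne_top).comp h1
  have hsplit : ∀ r, volume (E ∩ Metric.ball 0 r) = ENNReal.ofReal (m - V r) := by
    intro r
    have h1 := measureReal_inter_add_sdiff (μ := volume) (s := E)
      (Metric.isOpen_ball (x := (0 : Space d)) (ε := r)).measurableSet hfin
    rw [← ofReal_measureReal (ne_top_of_le_ne_top hfin (measure_mono inter_subset_left))]
    congr 1
    simp only [hV, hm]
    linarith
  have hm' : volume E = ENNReal.ofReal m := (ofReal_measureReal hfin).symm
  rw [hm', hcI m hm0.le] at hP
  -- Cutting between the radii `r` and `r + s` gives `c (m - V r)^p + c V(r+s)^p ≤ c m^p + 2 (C/s) V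
  -- r`, by optimality of `E`.
  have main : ∀ r s, 0 ≤ r → 0 < s → s ≤ 1 →
      V (r + s) ^ p ≤ (m ^ p / m + 2 * C / c) / s * V r := by
    intro r s hr hs hs1
    have h1 := isoProfile_add_isoProfile_le hd hE hfin (by positivity) hP hr
      (show r < r + s by linarith) (hCd d r (r + s) hr (by linarith))
    rw [hsplit, ← ofReal_measureReal (hVfin (r + s)), hcI _ (by linarith [hVm r]),
      hcI _ measureReal_nonneg, ← ENNReal.ofReal_add (by have := hVm r; positivity) (by positivity),
      add_sub_cancel_left] at h1
    have h2 := (ENNReal.ofReal_le_ofReal_iff (by positivity)).1 h1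
    -- Since `p < 1`, `(1 - x)^p ≥ 1 - x` on `[0, 1]`: the inner part loses only linearly in `V r`,
    -- while `V (r + s)` enters with the power `p`.
    have h3 : m ^ p - m ^ p / m * V r ≤ (m - V r) ^ p := by
      have h4 : (1 - V r / m) ≤ (1 - V r / m) ^ p := by
        refine Real.self_le_rpow_of_le_one ?_ ?_ hp1.le
        · have := (div_le_one hm0).2 (hVm r)
          linarith
        · have := div_nonneg (hV0 r) hm0.le
          linarith
      have h5 : m - V r = m * (1 - V r / m) := by field_simp
      rw [h5, Real.mul_rpow hm0.le (by
        have := (div_le_one hm0).2 (hVm r)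
        linarith)]
      refine le_trans (le_of_eq ?_) (mul_le_mul_of_nonneg_left h4 (by positivity))
      field_simp
    change c * (m - V r) ^ p + c * V (r + s) ^ p ≤ c * m ^ p + 2 * (C / s) * V r at h2
    have h6 : c * V (r + s) ^ p ≤ c * (m ^ p / m * V r) + 2 * (C / s) * V r := by
      nlinarith [mul_le_mul_of_nonneg_left h3 hc.le]
    have h7 : V (r + s) ^ p ≤ m ^ p / m * V r + 2 * C / c / s * V r := by
      refine le_of_mul_le_mul_left (h6.trans_eq ?_) hc
      field_simp
    refine h7.trans ?_
    rw [add_div, add_mul]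
    exact add_le_add (mul_le_mul_of_nonneg_right (le_div_self (by positivity) hs hs1) (hV0 r))
      le_rfl
  obtain ⟨r, hr⟩ := exists_eq_zero_of_rpow_le hanti hV0 hlim hp0 hp1 (by positivity) main
  exact ⟨r, (measureReal_eq_zero_iff (hVfin r)).1 hr⟩

/-- Removing a closed ball from an open set leaves an open set, and an open null set is empty. -/
theorem isBounded_of_isOpen_of_perimeter_le {d : ℕ} (hd : 2 ≤ d) {E : Set (Space d)}
    (hE : IsOpen E) (hfin : volume E ≠ ⊤) (h0 : volume E ≠ 0)
    (hP : perimeter E ≤ isoProfile d (volume E)) : Bornology.IsBounded E := by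
  obtain ⟨r, hr⟩ := exists_volume_diff_ball_eq_zero hd hE.measurableSet hfin h0 hP
  have h1 : E \ Metric.closedBall 0 r = ∅ := by
    refine (hE.sdiff Metric.isClosed_closedBall).measure_eq_zero_iff volume |>.1 ?_
    exact measure_mono_null (sdiff_subset_sdiff_right Metric.ball_subset_closedBall) hr
  exact Metric.isBounded_closedBall.subset (sdiff_eq_empty.1 h1)

/-! ### Perimeters of arbitrary balls and of disjoint unions. -/

theorem perimeter_closedBall_le {d : ℕ} (hd : 2 ≤ d) (c : Space d) {r : ℝ} (hr : 0 ≤ r) :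
    perimeter (Metric.closedBall c r) ≤
      ENNReal.ofReal (d * volume.real (Metric.ball (0 : Space d) 1) * r ^ (d - 1)) := by
  rw [perimeter_le_iff (by positivity)]
  intro φ hφ
  have htest : IsTestField fun y => φ (y + c) :=
    ⟨hφ.contDiff.comp (contDiff_id.add contDiff_const),
      hφ.hasCompactSupport.comp_homeomorph (Homeomorph.addRight c), fun x => hφ.norm_le_one _⟩
  refine le_trans (le_of_eq ?_) ((perimeter_le_iff (by positivity)).1
    (perimeter_closedBall_zero_le hd hr) _ htest)
  have h := (measurePreserving_add_right (volume : Measure (Space d)) c).setIntegral_preimage_emb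
    (measurableEmbedding_addRight c) (divergence φ) (Metric.closedBall c r)
  rw [← h]
  have e : (fun x => x + c) ⁻¹' Metric.closedBall c r = Metric.closedBall (0 : Space d) r := by
    ext x
    simp [dist_eq_norm]
  rw [e]
  refine integral_congr_ae (Filter.Eventually.of_forall fun x => ?_)
  simp only [divergence, fderiv_comp_add_right]

theorem perimeter_congr_ae {d : ℕ} {E F : Set (Space d)} (h : E =ᵐ[volume] F) :
    perimeter E = perimeter F := by
  unfold perimeter
  simp only [setIntegral_congr_set h]

theorem ball_ae_eq_closedBall {d : ℕ} (hd : 2 ≤ d) (c : Space d) (r : ℝ) :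
    Metric.ball c r =ᵐ[volume] Metric.closedBall c r := by
  have : NeZero d := ⟨by omega⟩
  refine Filter.EventuallyEq.symm ?_
  rw [← Metric.ball_union_sphere]
  exact union_ae_eq_left_of_ae_eq_empty (ae_eq_empty.2 (Measure.addHaar_sphere volume c r))

theorem perimeter_ball_le {d : ℕ} (hd : 2 ≤ d) (c : Space d) {r : ℝ} (hr : 0 ≤ r) :
    perimeter (Metric.ball c r) ≤
      ENNReal.ofReal (d * volume.real (Metric.ball (0 : Space d) 1) * r ^ (d - 1)) := by
  rw [perimeter_congr_ae (ball_ae_eq_closedBall hd c r)]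
  exact perimeter_closedBall_le hd c hr

theorem perimeter_iUnion_le {d : ℕ} {ι : Type*} [Fintype ι] {S : ι → Set (Space d)}
    (hS : ∀ i, MeasurableSet (S i)) (hdisj : Pairwise (Function.onFun Disjoint S)) {T : ι → ℝ}
    (hT0 : ∀ i, 0 ≤ T i) (hT : ∀ i, perimeter (S i) ≤ ENNReal.ofReal (T i)) :
    perimeter (⋃ i, S i) ≤ ENNReal.ofReal (∑ i, T i) := by
  rw [perimeter_le_iff (Finset.sum_nonneg fun i _ => hT0 i)]
  intro φ hφ
  rw [integral_iUnion_fintype hS hdisj fun i =>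
    (integrable_divergence hφ.contDiff hφ.hasCompactSupport).integrableOn]
  exact Finset.sum_le_sum fun i _ => (perimeter_le_iff (hT0 i)).1 (hT i) φ hφ

/-- The cutoffs give the upper bound; the lower bound is the isoperimetric inequality applied to the
ball itself. -/
theorem perimeter_unitBall {d : ℕ} (hd : 2 ≤ d) : perimeter (Metric.ball (0 : Space d) 1) =
    d * volume (Metric.ball (0 : Space d) 1) := by
  refine le_antisymm ((perimeter_ball_le hd 0 zero_le_one).trans_eq ?_) ?_
  · rw [one_pow, mul_one, ENNReal.ofReal_mul (by positivity), ENNReal.ofReal_natCast,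
      ofReal_measureReal (volume_unitBall_ne_top d)]
  · have h1 := isoProfile_ball hd zero_le_one
    have h2 := isoProfile_volume_le_perimeter hd Metric.isOpen_ball.measurableSet
      (volume_unitBall_ne_top d)
    simp only [one_pow, ENNReal.ofReal_one, one_mul, mul_one] at h1
    exact h1 ▸ h2

theorem ballPerimeter_eq_isoProfile {d : ℕ} (hd : 2 ≤ d) (m : ℝ) :
    ballPerimeter d m = isoProfile d (ENNReal.ofReal m) := by
  rw [ballPerimeter, isoProfile, perimeter_unitBall hd, mul_comm]

/-! ### Riesz energy: positivity on bounded sets and charges on spheres. -/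

theorem rpow_neg_le_rpow_neg {α : ℝ} (hα : 0 ≤ α) {x y : ℝ≥0∞} (h : x ≤ y) :
    y ^ (-α) ≤ x ^ (-α) := by
  rw [ENNReal.rpow_neg, ENNReal.rpow_neg]
  exact ENNReal.inv_le_inv.2 (ENNReal.rpow_le_rpow h hα)

/-- Bounded sets have positive Riesz energy. -/
theorem rieszEnergy_ne_zero_of_isBounded {d : ℕ} {α : ℝ} (hα : 0 < α) {A : Set (Space d)}
    (hA : MeasurableSet A) (hb : Bornology.IsBounded A) : rieszEnergy α A ≠ 0 := by
  have hD : Metric.ediam A + 1 ≠ ⊤ := by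
    simpa using hb.ediam_ne_top
  -- On `A × A`, which has mass 1, the kernel is at least this constant.
  have key : (Metric.ediam A + 1) ^ (-α) ≤ rieszEnergy α A := by
    refine le_iInf₂ fun μ hμ => ?_
    calc (Metric.ediam A + 1) ^ (-α) = ∫⁻ x in A, ∫⁻ y in A, (Metric.ediam A + 1) ^ (-α) ∂μ ∂μ := by
          simp [hμ]
      _ ≤ ∫⁻ x in A, ∫⁻ y in A, (edist x y) ^ (-α) ∂μ ∂μ := by
          refine setLIntegral_mono' hA fun x hx => setLIntegral_mono' hA fun y hy => ?_
          exact rpow_neg_le_rpow_neg hα.le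
            ((Metric.edist_le_ediam_of_mem hx hy).trans le_self_add)
      _ ≤ measureEnergy α μ :=
          lintegral_mono' Measure.restrict_le_self fun x =>
            lintegral_mono' Measure.restrict_le_self fun y => le_rfl
  intro h
  rw [h, nonpos_iff_eq_zero, ENNReal.rpow_eq_zero_iff] at key
  rcases key with ⟨_, h2⟩ | ⟨h1, _⟩
  · linarith
  · exact hD h1

/-- In polar coordinates the integrand is `y^(n-1-α)`, integrable at zero because `α < n`. -/
theorem setLIntegral_enorm_rpow_neg_lt_top {n : ℕ} (hn : 1 ≤ n) {α : ℝ} (hαn : α < n)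
    {r : ℝ} (hr : 0 < r) :
    ∫⁻ x in Metric.ball (0 : Space n) r, ‖x‖ₑ ^ (-α) < ⊤ := by
  have : NeZero n := ⟨by omega⟩
  have h1 : IntegrableOn (fun x : Space n => ‖x‖ ^ (-α)) (Metric.ball 0 r) := by
    rw [integrableOn_fun_norm_addHaar volume (f := fun y : ℝ => y ^ (-α)),
      finrank_euclideanSpace_fin]
    have h2 : IntegrableOn (fun y : ℝ => y ^ ((n : ℝ) - 1 - α)) (Ioo 0 r) :=
      (intervalIntegral.integrableOn_Ioo_rpow_iff hr).2 (by linarith)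
    refine h2.congr_fun (fun y hy => ?_) measurableSet_Ioo
    have : (y : ℝ) ^ (n - 1) = y ^ ((n : ℝ) - 1) := by
      rw [← Real.rpow_natCast, Nat.cast_sub hn, Nat.cast_one]
    simp only [smul_eq_mul]
    rw [this, ← Real.rpow_add hy.1]
    ring_nf
  refine lt_of_eq_of_lt ?_ h1.lintegral_lt_top
  refine lintegral_congr_ae ?_
  have h0 : ∀ᵐ x : Space n ∂volume.restrict (Metric.ball 0 r), x ≠ 0 :=
    ae_restrict_of_ae (Measure.ae_ne volume 0)
  filter_upwards [h0] with x hx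
  rw [← ENNReal.ofReal_rpow_of_pos (norm_pos_iff.2 hx), ofReal_norm]

/-- The graph map of the upper unit hemisphere. -/
def hemisphereGraph (n : ℕ) (y : Space n) : Space (n + 1) :=
  WithLp.toLp 2 (Fin.cons (Real.sqrt (1 - ‖y‖ ^ 2)) y.ofLp)

theorem continuous_hemisphereGraph (n : ℕ) : Continuous (hemisphereGraph n) := by
  refine (PiLp.continuous_toLp 2 _).comp (continuous_pi fun i => ?_)
  refine Fin.cases ?_ (fun j => ?_) i
  · simp only [Fin.cons_zero]
    fun_prop
  · simp only [Fin.cons_succ]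
    fun_prop

theorem norm_hemisphereGraph {n : ℕ} {y : Space n} (hy : ‖y‖ ≤ 1) : ‖hemisphereGraph n y‖ = 1 := by
  have h0 : (0 : ℝ) ≤ 1 - ‖y‖ ^ 2 := by nlinarith [norm_nonneg y]
  rw [← sq_eq_sq₀ (norm_nonneg _) zero_le_one, EuclideanSpace.norm_sq_eq, Fin.sum_univ_succ]
  simp only [hemisphereGraph, Fin.cons_zero, Fin.cons_succ, Real.norm_eq_abs, sq_abs,
    Real.sq_sqrt h0]
  have : ‖y‖ ^ 2 = ∑ i, y i ^ 2 := by simp [EuclideanSpace.norm_sq_eq]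
  rw [← this]
  ring

/-- Forgetting the first coordinate is a contraction, so lifting a charge from the flat ball to the
hemisphere does not increase its energy. -/
theorem edist_le_edist_hemisphereGraph {n : ℕ} (y z : Space n) :
    edist y z ≤ edist (hemisphereGraph n y) (hemisphereGraph n z) := by
  rw [edist_dist, edist_dist]
  refine ENNReal.ofReal_le_ofReal ?_
  rw [← sq_le_sq₀ dist_nonneg dist_nonneg, EuclideanSpace.dist_sq_eq, EuclideanSpace.dist_sq_eq,
    Fin.sum_univ_succ]
  simp only [hemisphereGraph, Fin.cons_succ]
  exact le_add_of_nonneg_left (by positivity)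

/-- There is a charge distribution of finite energy on the unit sphere. -/
theorem exists_measure_sphere_measureEnergy_lt_top {d : ℕ} (hd : 2 ≤ d) {α : ℝ} (hα : 0 < α)
    (hαd : α < (d : ℝ) - 1) : ∃ ν : Measure (Space d), IsProbabilityMeasure ν ∧
      ν (Metric.sphere 0 1) = 1 ∧ measureEnergy α ν < ⊤ := by
  obtain ⟨n, rfl⟩ : ∃ n, d = n + 1 := ⟨d - 1, by omega⟩
  have hn : 1 ≤ n := by omega
  have hαn : α < n := by push_cast at hαd; linarith
  set B := Metric.ball (0 : Space n) 1 with hB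
  set a := (volume B)⁻¹ with ha
  have hat : a ≠ ⊤ := ENNReal.inv_ne_top.2 (volume_unitBall_ne_zero n)
  have hmeas : Measurable (hemisphereGraph n) := (continuous_hemisphereGraph n).measurable
  -- The charge is Lebesgue measure on the unit ball of dimension `n = d - 1`, lifted to the
  -- hemisphere; `α < d - 1` is what makes its energy finite.
  set κ : Measure (Space (n + 1)) := Measure.map (hemisphereGraph n) (volume.restrict B) with hκ
  have huniv : (a • κ) univ = 1 := by
    rw [Measure.smul_apply, hκ, Measure.map_apply hmeas MeasurableSet.univ, preimage_univ,
      Measure.restrict_apply_univ, smul_eq_mul, ha,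
      ENNReal.inv_mul_cancel (volume_unitBall_ne_zero n) (volume_unitBall_ne_top n)]
  refine ⟨a • κ, ⟨huniv⟩, ?_, ?_⟩
  · rw [← huniv, Measure.smul_apply, Measure.smul_apply, hκ,
      Measure.map_apply hmeas Metric.isClosed_sphere.measurableSet,
      Measure.map_apply hmeas MeasurableSet.univ]
    congr 1
    refine measure_congr (Filter.Eventually.mono
      (ae_restrict_mem Metric.isOpen_ball.measurableSet) fun y hy => ?_)
    have : hemisphereGraph n y ∈ Metric.sphere (0 : Space (n + 1)) 1 := by
      rw [mem_sphere_zero_iff_norm]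
      exact norm_hemisphereGraph (mem_ball_zero_iff.1 hy).le
    exact propext ⟨fun _ => mem_univ _, fun _ => this⟩
  · set M := ∫⁻ x in Metric.ball (0 : Space n) 2, ‖x‖ₑ ^ (-α) with hM
    have hMt : M < ⊤ := setLIntegral_enorm_rpow_neg_lt_top hn hαn two_pos
    have inner : ∀ y ∈ B, ∫⁻ z, edist (hemisphereGraph n y) z ^ (-α) ∂κ ≤ M := by
      intro y hy
      calc ∫⁻ z, edist (hemisphereGraph n y) z ^ (-α) ∂κ
          ≤ ∫⁻ z in B, edist (hemisphereGraph n y) (hemisphereGraph n z) ^ (-α) :=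
            lintegral_map_le _ _
        _ ≤ ∫⁻ z in B, ‖z - y‖ₑ ^ (-α) := by
            refine lintegral_mono fun z => rpow_neg_le_rpow_neg hα.le ?_
            rw [← edist_eq_enorm_sub, edist_comm]
            exact edist_le_edist_hemisphereGraph y z
        _ = ∫⁻ x in (fun x => x + y) ⁻¹' B, ‖x‖ₑ ^ (-α) := by
            have := (measurePreserving_add_right (volume : Measure (Space n)) y
              ).setLIntegral_comp_preimage_emb (measurableEmbedding_addRight y)
              (fun z => ‖z - y‖ₑ ^ (-α)) B
            simpa using this.symm
        -- The ball `B` translated by a point of `B` stays within the ball of radius 2.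
        _ ≤ M := by
            refine lintegral_mono_set fun x hx => ?_
            rw [mem_preimage, hB, mem_ball_zero_iff] at hx
            rw [hB, mem_ball_zero_iff] at hy
            rw [mem_ball_zero_iff]
            have := norm_sub_le (x + y) y
            rw [add_sub_cancel_right] at this
            linarith
    have h1 : ∫⁻ x, ∫⁻ y, edist x y ^ (-α) ∂κ ∂κ ≤ M * volume B := by
      refine (lintegral_map_le _ _).trans ?_
      rw [← setLIntegral_const]
      exact setLIntegral_mono' Metric.isOpen_ball.measurableSet inner
    have h2 : measureEnergy α (a • κ) = a * (a * ∫⁻ x, ∫⁻ y, edist x y ^ (-α) ∂κ ∂κ) := by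
      simp only [measureEnergy, lintegral_smul_measure, smul_eq_mul]
      rw [lintegral_const_mul' _ _ hat]
    rw [h2]
    refine ENNReal.mul_lt_top hat.lt_top (ENNReal.mul_lt_top hat.lt_top (h1.trans_lt ?_))
    exact ENNReal.mul_lt_top hMt (volume_unitBall_ne_top n).lt_top

theorem measureEnergy_map_homothety {d : ℕ} (α : ℝ) (ν : Measure (Space d)) (c : Space d) {s : ℝ}
    (hs : 0 < s) : measureEnergy α (Measure.map (fun x => c + s • x) ν) =
      ENNReal.ofReal (s ^ (-α)) * measureEnergy α ν := by
  have hemb : MeasurableEmbedding fun x : Space d => c + s • x :=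
    (measurableEmbedding_addLeft c).comp (measurableEmbedding_const_smul₀ hs.ne')
  have hsα : ENNReal.ofReal s ^ (-α) ≠ ⊤ := by
    rw [ENNReal.ofReal_rpow_of_pos hs]
    exact ENNReal.ofReal_ne_top
  have hk : ∀ x y : Space d, edist (c + s • x) (c + s • y) ^ (-α) =
      ENNReal.ofReal s ^ (-α) * edist x y ^ (-α) := fun x y => by
    rw [edist_add_left, edist_smul₀, ENNReal.smul_def, smul_eq_mul,
      ENNReal.mul_rpow_of_ne_top ENNReal.coe_ne_top (edist_ne_top x y),
      show ((‖s‖₊ : NNReal) : ℝ≥0∞) = ENNReal.ofReal s by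
        rw [← enorm_eq_nnnorm, Real.enorm_of_nonneg hs.le]]
  simp only [measureEnergy, hemb.lintegral_map, hk]
  simp only [lintegral_const_mul' _ _ hsα]
  rw [ENNReal.ofReal_rpow_of_pos hs]

theorem ae_mem_of_measure_eq_one {Ω : Type*} [MeasurableSpace Ω] {ν : Measure Ω}
    [IsProbabilityMeasure ν] {S : Set Ω} (hS : MeasurableSet S) (h : ν S = 1) : ∀ᵐ x ∂ν, x ∈ S :=
  (prob_compl_eq_zero_iff hS).2 h

/-- The Riesz energy of a set that contains `N` spheres of radius `s` far from each other. -/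
theorem rieszEnergy_le_of_spheres {d : ℕ} {α : ℝ} (hα : 0 < α) {ν : Measure (Space d)}
    [IsProbabilityMeasure ν] (hν : ν (Metric.sphere 0 1) = 1) {A : Set (Space d)}
    (hA : MeasurableSet A) {N : ℕ} (hN : 0 < N) {c : Fin N → Space d} {s D : ℝ} (hs : 0 < s)
    (hD : 0 < D) (hc : ∀ i j, i ≠ j → D + 2 * s ≤ dist (c i) (c j))
    (hsA : ∀ i, Metric.sphere (c i) s ⊆ A) :
    rieszEnergy α A ≤ ENNReal.ofReal ((N : ℝ)⁻¹ * s ^ (-α)) * measureEnergy α ν +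
      ENNReal.ofReal (D ^ (-α)) := by
  set T : Fin N → Space d → Space d := fun i x => c i + s • x with hT
  have hTm : ∀ i, Measurable (T i) := fun i => by
    simp only [hT]
    fun_prop
  set κ : Fin N → Measure (Space d) := fun i => Measure.map (T i) ν with hκ
  have hκp : ∀ i, IsProbabilityMeasure (κ i) := fun i =>
    Measure.isProbabilityMeasure_map (hTm i).aemeasurable
  have hsph : ∀ i, ∀ᵐ x ∂κ i, x ∈ Metric.sphere (c i) s := by
    intro i
    refine (ae_map_iff (hTm i).aemeasurable Metric.isClosed_sphere.measurableSet).2 ?_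
    filter_upwards [ae_mem_of_measure_eq_one Metric.isClosed_sphere.measurableSet hν] with x hx
    rw [mem_sphere_zero_iff_norm] at hx
    simp [hT, norm_smul, hx, abs_of_pos hs]
  have hκA : ∀ i, κ i A = 1 := fun i =>
    (prob_compl_eq_zero_iff hA).1 (show ∀ᵐ x ∂κ i, x ∈ A from (hsph i).mono fun x hx => hsA i hx)
  set a : ℝ≥0∞ := (N : ℝ≥0∞)⁻¹ with ha
  have hN0 : (N : ℝ≥0∞) ≠ 0 := by exact_mod_cast hN.ne'
  have hat : a ≠ ⊤ := ENNReal.inv_ne_top.2 hN0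
  have haN : a * N = 1 := ENNReal.inv_mul_cancel hN0 (ENNReal.natCast_ne_top N)
  -- Equal shares on the `N` spheres: the `N` self-energies carry the weight `N⁻²` each, and the
  -- interactions have total weight at most 1 and kernel at most `D^(-α)`.
  set μ : Measure (Space d) := a • ∑ i, κ i with hμ
  have hμA : μ A = 1 := by
    rw [hμ, Measure.smul_apply, Measure.finsetSum_apply]
    simp [hκA, haN]
  refine (iInf₂_le μ hμA).trans ?_
  have hL : ∀ f : Space d → ℝ≥0∞, ∫⁻ x, f x ∂μ = a * ∑ i, ∫⁻ x, f x ∂κ i := fun f => by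
    rw [hμ, lintegral_smul_measure, lintegral_finsetSum_measure, smul_eq_mul]
  have hfar : ∀ i j, i ≠ j → ∀ x ∈ Metric.sphere (c i) s,
      ∫⁻ y, edist x y ^ (-α) ∂κ j ≤ ENNReal.ofReal (D ^ (-α)) := by
    intro i j hij x hx
    calc ∫⁻ y, edist x y ^ (-α) ∂κ j ≤ ∫⁻ _, ENNReal.ofReal (D ^ (-α)) ∂κ j := by
          refine lintegral_mono_ae ((hsph j).mono fun y hy => ?_)
          rw [← ENNReal.ofReal_rpow_of_pos hD, edist_dist]
          refine rpow_neg_le_rpow_neg hα.le (ENNReal.ofReal_le_ofReal ?_)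
          have h1 := hc i j hij
          have h2 := dist_triangle4 (c i) x y (c j)
          rw [Metric.mem_sphere] at hx hy
          rw [dist_comm (c i) x] at h2
          linarith
      _ = ENNReal.ofReal (D ^ (-α)) := by simp
  have hin : ∀ i, ∀ x ∈ Metric.sphere (c i) s, ∫⁻ y, edist x y ^ (-α) ∂μ ≤
      a * (∫⁻ y, edist x y ^ (-α) ∂κ i) + ENNReal.ofReal (D ^ (-α)) := by
    intro i x hx
    rw [hL, ← Finset.add_sum_erase _ _ (Finset.mem_univ i), mul_add]
    gcongr
    calc a * ∑ j ∈ Finset.univ.erase i, ∫⁻ y, edist x y ^ (-α) ∂κ j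
        ≤ a * ∑ j : Fin N, ENNReal.ofReal (D ^ (-α)) := by
          gcongr
          refine (Finset.sum_le_sum fun j hj => hfar i j (Finset.ne_of_mem_erase hj).symm x hx).trans
            (Finset.sum_le_sum_of_subset (Finset.erase_subset _ _))
      _ = ENNReal.ofReal (D ^ (-α)) := by
          rw [Finset.sum_const, Finset.card_univ, Fintype.card_fin, nsmul_eq_mul, ← mul_assoc, haN,
            one_mul]
  have hout : ∀ i, ∫⁻ x, ∫⁻ y, edist x y ^ (-α) ∂μ ∂κ i ≤
      a * (ENNReal.ofReal (s ^ (-α)) * measureEnergy α ν) + ENNReal.ofReal (D ^ (-α)) := by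
    intro i
    refine (lintegral_mono_ae ((hsph i).mono (hin i))).trans_eq ?_
    rw [lintegral_add_right _ measurable_const, lintegral_const_mul' _ _ hat, lintegral_const,
      measure_univ, mul_one, ← measureEnergy_map_homothety α ν (c i) hs]
    rfl
  calc measureEnergy α μ = a * ∑ i, ∫⁻ x, ∫⁻ y, edist x y ^ (-α) ∂μ ∂κ i := hL _
    _ ≤ a * ∑ i : Fin N, (a * (ENNReal.ofReal (s ^ (-α)) * measureEnergy α ν) +
          ENNReal.ofReal (D ^ (-α))) := by
        gcongr with i
        exact hout i
    _ = a * (ENNReal.ofReal (s ^ (-α)) * measureEnergy α ν) + ENNReal.ofReal (D ^ (-α)) := by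
        rw [Finset.sum_const, Finset.card_univ, Fintype.card_fin, nsmul_eq_mul, ← mul_assoc, haN,
          one_mul]
    _ = _ := by
        rw [ENNReal.ofReal_mul (by positivity), mul_assoc, ENNReal.ofReal_inv_of_pos
          (by exact_mod_cast hN), ENNReal.ofReal_natCast]

/-! ### A ball with tiny satellites. -/

/-- Near one of the pieces, a union of far apart balls coincides with that piece. -/
theorem frontier_subset_frontier_iUnion {d : ℕ} {ι : Type*} {c : ι → Space d} {r : ι → ℝ}
    {R D : ℝ} (hrR : ∀ i, r i ≤ R) (hD : 0 < D) (hc : ∀ i j, i ≠ j → D + 2 * R ≤ dist (c i) (c j))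
    {S : ι → Set (Space d)} (hS : ∀ i, S i ⊆ Metric.closedBall (c i) (r i)) (i : ι) :
    frontier (S i) ⊆ frontier (⋃ j, S j) := by
  -- The frontier is local, and in this open ball the union is just `S i`, every other piece being
  -- farther away.
  have e : (⋃ j, S j) ∩ Metric.ball (c i) (r i + D) = S i ∩ Metric.ball (c i) (r i + D) := by
    refine Subset.antisymm ?_ (inter_subset_inter_left _ (subset_iUnion S i))
    rintro x ⟨hx, hxU⟩
    obtain ⟨j, hj⟩ := mem_iUnion.1 hx
    by_cases hij : i = j
    · exact ⟨hij ▸ hj, hxU⟩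
    · exfalso
      have h1 := hS j hj
      rw [Metric.mem_closedBall] at h1
      rw [Metric.mem_ball] at hxU
      have h2 := dist_triangle_left (c i) (c j) x
      have := hc i j hij
      have := hrR i
      have := hrR j
      linarith
  intro x hx
  have hxU : x ∈ Metric.ball (c i) (r i + D) := by
    have : x ∈ Metric.closedBall (c i) (r i) :=
      closure_minimal (hS i) Metric.isClosed_closedBall (frontier_subset_closure hx)
    rw [Metric.mem_closedBall] at this
    rw [Metric.mem_ball]
    linarith
  have h1 : x ∈ frontier (S i) ∩ Metric.ball (c i) (r i + D) := ⟨hx, hxU⟩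
  rw [← frontier_inter_open_inter Metric.isOpen_ball, ← e,
    frontier_inter_open_inter Metric.isOpen_ball] at h1
  exact h1.1

/-- With `r = N^(-1/β)` and `α < β < d - 1`, the quantities `N r^d`, `N r^(d-1)` and `N⁻¹ r^(-α)`
are negative powers of `N`. The radius `r/2` costs only a factor `2^α`. -/
theorem exists_small_balls_parameters {d : ℕ} (hd : 2 ≤ d) {α : ℝ} (hα : 0 < α)
    (hαd : α < (d : ℝ) - 1) {R δ : ℝ} (hR : 0 < R) (hδ : 0 < δ) :
    ∃ (N : ℕ) (r : ℝ), 0 < N ∧ 0 < r ∧ r ≤ R ∧ N * r ^ d < R ^ d ∧ N * r ^ (d - 1) ≤ δ ∧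
      (N : ℝ)⁻¹ * (r / 2) ^ (-α) ≤ δ := by
  obtain ⟨β, hαβ, hβd⟩ := exists_between hαd
  have hβ : 0 < β := hα.trans hαβ
  have hN : Filter.Tendsto (fun N : ℕ => (N : ℝ)) Filter.atTop Filter.atTop :=
    tendsto_natCast_atTop_atTop
  have lim : ∀ y : ℝ, 0 < y → Filter.Tendsto (fun N : ℕ => (N : ℝ) ^ (-y)) Filter.atTop (nhds 0) :=
    fun y hy => (tendsto_rpow_neg_atTop hy).comp hN
  have hy1 : 0 < (d : ℝ) / β - 1 := by
    have := (one_lt_div hβ).2 (by linarith : β < (d : ℝ))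
    linarith
  have hy2 : 0 < ((d : ℝ) - 1) / β - 1 := by
    have := (one_lt_div hβ).2 hβd
    linarith
  have hy3 : 0 < 1 - α / β := by
    have := (div_lt_one hβ).2 hαβ
    linarith
  have l0 := lim (1 / β) (by positivity)
  have l1 := lim _ hy1
  have l2 := lim _ hy2
  have l3 := (lim _ hy3).const_mul (2 ^ α)
  rw [mul_zero] at l3
  obtain ⟨N, hN1, hN0, e0, e1, e2, e3⟩ := ((Filter.eventually_ge_atTop 1).and
    ((Filter.eventually_gt_atTop 0).and
    ((l0.eventually (gt_mem_nhds hR)).and ((l1.eventually (gt_mem_nhds (pow_pos hR d))).and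
    ((l2.eventually (gt_mem_nhds hδ)).and (l3.eventually (gt_mem_nhds hδ))))))).exists
  have hNr : (0 : ℝ) < N := by exact_mod_cast hN0
  have hpow : ∀ k : ℕ, (N : ℝ) * ((N : ℝ) ^ (-(1 / β))) ^ k = (N : ℝ) ^ (-((k : ℝ) / β - 1)) := by
    intro k
    rw [← Real.rpow_natCast, ← Real.rpow_mul hNr.le]
    nth_rewrite 1 [← Real.rpow_one (N : ℝ)]
    rw [← Real.rpow_add hNr]
    congr 1
    ring
  refine ⟨N, (N : ℝ) ^ (-(1 / β)), hN0, by positivity, e0.le, ?_, ?_, ?_⟩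
  · rw [hpow]
    exact e1
  · rw [hpow, Nat.cast_sub (by omega), Nat.cast_one]
    exact e2.le
  · refine le_trans (le_of_eq ?_) e3.le
    rw [Real.div_rpow (by positivity) zero_le_two, ← Real.rpow_mul hNr.le, Real.rpow_neg zero_le_two,
      div_inv_eq_mul, ← Real.rpow_neg_one, ← mul_assoc, ← Real.rpow_add hNr, mul_comm]
    congr 2
    ring

/-- A ball with a large number of tiny satellites: its perimeter is almost that of a ball of the
same volume, while a unit charge on it, or on its boundary, has almost no energy. -/
theorem exists_ball_with_satellites {d : ℕ} (hd : 2 ≤ d) {α : ℝ} (hα : 0 < α)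
    (hαd : α < (d : ℝ) - 1) {S : Space d → ℝ → Set (Space d)}
    (hS : S = Metric.ball ∨ S = Metric.closedBall) {v : ℝ≥0∞} (hv0 : v ≠ 0) (hv : v ≠ ⊤) {δ : ℝ}
    (hδ : 0 < δ) : ∃ (n : ℕ) (c : Fin n → Space d) (r : Fin n → ℝ),
      volume (⋃ i, S (c i) (r i)) = v ∧
      perimeter (⋃ i, S (c i) (r i)) ≤ isoProfile d v + ENNReal.ofReal δ ∧
      rieszEnergy α (⋃ i, S (c i) (r i)) ≤ ENNReal.ofReal δ ∧
      rieszEnergy α (frontier (⋃ i, S (c i) (r i))) ≤ ENNReal.ofReal δ := by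
  have : NeZero d := ⟨by omega⟩
  obtain ⟨R, hR0, hRv⟩ := exists_radius_of_volume hd hv
  have hR : 0 < R := by
    refine lt_of_le_of_ne hR0 fun h => hv0 ?_
    rw [hRv, ← h, zero_pow (by omega), ENNReal.ofReal_zero, zero_mul]
  obtain ⟨ν, hνp, hν1, hνE⟩ := exists_measure_sphere_measureEnergy_lt_top hd hα hαd
  set w := volume.real (Metric.ball (0 : Space d) 1) with hw
  set C := (measureEnergy α ν).toReal with hC
  have hC0 : 0 ≤ C := ENNReal.toReal_nonneg
  have hw0 : 0 ≤ w := measureReal_nonneg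
  -- This `ε` makes both the satellites' perimeter `d w ε` and the energy bound `ε C + ε` at most
  -- `δ`.
  set ε : ℝ := δ / (d * w + C + 1) with hε
  have hε0 : 0 < ε := by positivity
  have hεδ : ε * (d * w + C + 1) = δ := div_mul_cancel₀ _ (by positivity)
  have hε1 : d * w * ε ≤ δ := by nlinarith [mul_nonneg hε0.le hC0]
  have hε2 : ε * C + ε ≤ δ := by nlinarith [mul_nonneg hε0.le (by positivity : 0 ≤ d * w)]
  obtain ⟨N, r, hN, hr, hrR, hvol, hper, hen⟩ := exists_small_balls_parameters hd hα hαd hR hε0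
  set D : ℝ := ε ^ (-(1 / α)) with hD
  have hD0 : 0 < D := by positivity
  have hDα : D ^ (-α) = ε := by
    rw [hD, ← Real.rpow_mul hε0.le, neg_mul_neg, one_div_mul_cancel hα.ne', Real.rpow_one]
  -- The radius of the main ball, fixed by the volume that the satellites leave over.
  set ρ : ℝ := (R ^ d - N * r ^ d) ^ ((d : ℝ)⁻¹) with hρ
  have hρ0 : 0 < ρ := Real.rpow_pos_of_pos (by linarith) _
  have hρd : ρ ^ d = R ^ d - N * r ^ d := Real.rpow_inv_natCast_pow (by linarith) (by omega)
  have hρR : ρ ≤ R := by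
    refine (pow_le_pow_iff_left₀ hρ0.le hR0 (n := d) (by omega)).1 ?_
    rw [hρd]
    have : 0 ≤ (N : ℝ) * r ^ d := by positivity
    linarith
  set L : ℝ := D + 2 * R with hL
  have hL0 : 0 < L := by positivity
  -- The centres are equally spaced on a coordinate axis; index 0 is the main ball, and the
  -- successors are the satellites, which carry all the charge.
  set c : Fin (N + 1) → Space d := fun i => EuclideanSpace.single 0 (L * (i : ℕ)) with hc
  set q : Fin (N + 1) → ℝ := Fin.cons ρ fun _ => r with hq
  have hq0 : ∀ i, 0 < q i := fun i => by
    refine Fin.cases ?_ (fun j => ?_) i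
    · simpa [hq] using hρ0
    · simpa [hq] using hr
  have hqR : ∀ i, q i ≤ R := fun i => by
    refine Fin.cases ?_ (fun j => ?_) i
    · simpa [hq] using hρR
    · simpa [hq] using hrR
  have hdist : ∀ i j, i ≠ j → D + 2 * R ≤ dist (c i) (c j) := by
    intro i j hij
    rw [← hL]
    simp only [hc]
    rw [PiLp.dist_single_same, Real.dist_eq, ← mul_sub, abs_mul, abs_of_pos hL0]
    refine le_mul_of_one_le_right hL0.le ?_
    have h1 : ((i : ℕ) : ℤ) - ((j : ℕ) : ℤ) ≠ 0 := fun h => hij (Fin.ext (by omega))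
    exact_mod_cast Int.one_le_abs h1
  have hsub : ∀ x t, S x t ⊆ Metric.closedBall x t := by
    rcases hS with rfl | rfl
    · exact fun x t => Metric.ball_subset_closedBall
    · exact fun x t => Subset.rfl
  have hsup : ∀ x t, Metric.ball x t ⊆ S x t := by
    rcases hS with rfl | rfl
    · exact fun x t => Subset.rfl
    · exact fun x t => Metric.ball_subset_closedBall
  have hmeas : ∀ x t, MeasurableSet (S x t) := by
    rcases hS with rfl | rfl
    · exact fun x t => Metric.isOpen_ball.measurableSet
    · exact fun x t => Metric.isClosed_closedBall.measurableSet
  have hfront : ∀ x t, 0 < t → Metric.sphere x t ⊆ frontier (S x t) := by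
    rcases hS with rfl | rfl
    · exact fun x t ht => (frontier_ball x ht.ne').ge
    · exact fun x t ht => (frontier_closedBall x ht.ne').ge
  have hSvol : ∀ x t, 0 ≤ t → volume (S x t) =
      ENNReal.ofReal (t ^ d) * volume (Metric.ball (0 : Space d) 1) := by
    intro x t ht
    rcases hS with rfl | rfl
    · rw [Measure.addHaar_ball _ _ ht, finrank_euclideanSpace_fin]
    · rw [Measure.addHaar_closedBall _ _ ht, finrank_euclideanSpace_fin]
  have hSper : ∀ x t, 0 ≤ t → perimeter (S x t) ≤ ENNReal.ofReal (d * w * t ^ (d - 1)) := by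
    intro x t ht
    rcases hS with rfl | rfl
    · exact perimeter_ball_le hd x ht
    · exact perimeter_closedBall_le hd x ht
  have hdisj : Pairwise (Function.onFun Disjoint fun i => S (c i) (q i)) := by
    intro i j hij
    refine (Metric.closedBall_disjoint_closedBall ?_).mono (hsub _ _) (hsub _ _)
    have := hdist i j hij
    have := hqR i
    have := hqR j
    linarith
  -- Used with `s = r/2`, whose spheres lie inside the satellites even when these are open, and with
  -- `s = r`, whose spheres lie in the frontier.
  have henergy : ∀ s A, 0 < s → s ≤ R → r / 2 ≤ s → MeasurableSet A →
      (∀ i : Fin N, Metric.sphere (c i.succ) s ⊆ A) → rieszEnergy α A ≤ ENNReal.ofReal δ := by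
    intro s A hs hsR hrs hA hsA
    refine (rieszEnergy_le_of_spheres hα hν1 hA hN (c := fun i => c i.succ) hs hD0
      (fun i j hij => ?_) hsA).trans ?_
    · have := hdist i.succ j.succ (fun h => hij (Fin.succ_injective _ h))
      linarith
    · rw [← ENNReal.ofReal_toReal hνE.ne, ← hC, hDα, ← ENNReal.ofReal_mul (by positivity),
        ← ENNReal.ofReal_add (by positivity) hε0.le]
      refine ENNReal.ofReal_le_ofReal (le_trans ?_ hε2)
      have h1 : s ^ (-α) ≤ (r / 2) ^ (-α) :=
        Real.rpow_le_rpow_of_nonpos (by positivity) hrs (by linarith)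
      have h2 : (N : ℝ)⁻¹ * s ^ (-α) ≤ ε := le_trans (by gcongr) hen
      gcongr
  refine ⟨N + 1, c, q, ?_, ?_, ?_, ?_⟩
  · rw [measure_iUnion hdisj fun i => hmeas _ _, tsum_fintype,
      Finset.sum_congr rfl fun i _ => hSvol (c i) (q i) (hq0 i).le, ← Finset.sum_mul,
      ← ENNReal.ofReal_sum_of_nonneg fun i _ => pow_nonneg (hq0 i).le d, hRv, Fin.sum_univ_succ]
    congr 2
    simp [hq, hρd]
  · refine (perimeter_iUnion_le (fun i => hmeas _ _) hdisj
      (fun i => by have := hq0 i; positivity) fun i => hSper (c i) (q i) (hq0 i).le).trans ?_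
    rw [hRv, isoProfile_ball hd hR0, ← ofReal_measureReal (volume_unitBall_ne_top d), ← hw,
      ← ENNReal.ofReal_natCast, ← ENNReal.ofReal_mul (by positivity),
      ← ENNReal.ofReal_mul (by positivity), ← ENNReal.ofReal_add (by positivity) hδ.le,
      ← Finset.mul_sum, Fin.sum_univ_succ]
    refine ENNReal.ofReal_le_ofReal (le_trans ?_ (add_le_add le_rfl hε1))
    rw [← mul_add]
    gcongr
    · simpa [hq] using hρR
    · simpa [hq] using hper
  · refine henergy (r / 2) _ (by positivity) (by linarith) le_rfl
      (MeasurableSet.iUnion fun i => hmeas _ _) fun i => ?_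
    refine Subset.trans ?_ (subset_iUnion _ i.succ)
    refine Subset.trans ?_ (hsup _ _)
    intro x hx
    rw [Metric.mem_sphere] at hx
    rw [Metric.mem_ball, hx]
    simpa [hq] using hr
  · refine henergy r _ hr hrR (by linarith) isClosed_frontier.measurableSet fun i => ?_
    refine Subset.trans ?_ (frontier_subset_frontier_iUnion hqR hD0 hdist
      (fun j => hsub (c j) (q j)) i.succ)
    simpa [hq] using hfront (c i.succ) r hr

/-! ### Infimum, non-attainment and the main theorem. -/

/-- The function `I` stands for the Riesz energy of `E` or of its frontier, so that both functionals
are treated at once. -/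
theorem iInf_eq_of_forall_exists_le {X : Type*} {𝒜 : Set X} {f P I : X → ℝ≥0∞} {p a : ℝ≥0∞}
    (ha : a ≠ ⊤) (hf : ∀ E ∈ 𝒜, f E = P E + a * I E) (hlow : ∀ E ∈ 𝒜, p ≤ P E)
    (happrox : ∀ δ : ℝ, 0 < δ → ∃ E ∈ 𝒜, P E ≤ p + ENNReal.ofReal δ ∧ I E ≤ ENNReal.ofReal δ) :
    ⨅ E ∈ 𝒜, f E = p := by
  refine le_antisymm ?_ (le_iInf₂ fun E hE => (hlow E hE).trans (hf E hE ▸ le_self_add))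
  refine ENNReal.le_of_forall_pos_le_add fun η hη _ => ?_
  set δ : ℝ := η / (1 + a.toReal) with hδ
  have ha0 : 0 ≤ a.toReal := ENNReal.toReal_nonneg
  have hδ0 : 0 < δ := by positivity
  obtain ⟨E, hE, hP, hI⟩ := happrox δ hδ0
  calc ⨅ E ∈ 𝒜, f E ≤ f E := iInf₂_le E hE
    _ = P E + a * I E := hf E hE
    _ ≤ p + ENNReal.ofReal δ + a * ENNReal.ofReal δ := by gcongr
    _ = p + ENNReal.ofReal (δ * (1 + a.toReal)) := by
        rw [mul_add, mul_one, ENNReal.ofReal_add hδ0.le (by positivity), ENNReal.ofReal_mul hδ0.le,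
          ENNReal.ofReal_toReal ha, mul_comm a, add_assoc]
    _ = p + η := by
        rw [hδ, div_mul_cancel₀ _ (by positivity), ENNReal.ofReal_coe_nnreal]

/-- As `P` alone already reaches at least the finite infimum `p`, a minimizer would have `P E ≤ p`
and no room left for `a * I E`. -/
theorem not_exists_isMinOn_of_iInf_eq {X : Type*} {𝒜 : Set X} {f P I : X → ℝ≥0∞} {p a : ℝ≥0∞}
    (hp : p ≠ ⊤) (ha : a ≠ 0) (hf : ∀ E ∈ 𝒜, f E = P E + a * I E) (hlow : ∀ E ∈ 𝒜, p ≤ P E)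
    (hinf : ⨅ E ∈ 𝒜, f E = p) (hpos : ∀ E ∈ 𝒜, P E ≤ p → I E ≠ 0) :
    ¬ ∃ E ∈ 𝒜, IsMinOn f 𝒜 E := by
  rintro ⟨E, hE, hmin⟩
  have h1 : P E + a * I E ≤ p := by
    rw [← hf E hE, ← hinf]
    exact le_iInf₂ fun F hF => hmin hF
  have hPE : P E ≤ p := le_self_add.trans h1
  have h2 : p + a * I E ≤ p + 0 := by
    rw [add_zero]
    exact (add_le_add (hlow E hE) le_rfl).trans h1
  have h3 := (ENNReal.add_le_add_iff_left hp).1 h2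
  rw [nonpos_iff_eq_zero, mul_eq_zero] at h3
  exact h3.elim ha (hpos E hE hPE)

theorem isoProfile_ne_top {d : ℕ} (hd : 2 ≤ d) {v : ℝ≥0∞} (hv : v ≠ ⊤) : isoProfile d v ≠ ⊤ := by
  obtain ⟨r, hr0, rfl⟩ := exists_radius_of_volume hd hv
  rw [isoProfile_ball hd hr0]
  exact ENNReal.mul_ne_top (ENNReal.mul_ne_top (ENNReal.natCast_ne_top d)
    (volume_unitBall_ne_top d)) ENNReal.ofReal_ne_top

theorem exists_ball_of_volume {d : ℕ} (hd : 2 ≤ d) {S : Space d → ℝ → Set (Space d)}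
    (hS : S = Metric.ball ∨ S = Metric.closedBall) {v : ℝ≥0∞} (hv : v ≠ ⊤) :
    ∃ r : ℝ, volume (S 0 r) = v ∧ perimeter (S 0 r) ≤ isoProfile d v := by
  have : NeZero d := ⟨by omega⟩
  obtain ⟨r, hr0, rfl⟩ := exists_radius_of_volume hd hv
  have e : isoProfile d (ENNReal.ofReal (r ^ d) * volume (Metric.ball (0 : Space d) 1)) =
      ENNReal.ofReal (d * volume.real (Metric.ball (0 : Space d) 1) * r ^ (d - 1)) := by
    rw [isoProfile_ball hd hr0, ENNReal.ofReal_mul (by positivity),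
      ENNReal.ofReal_mul (by positivity), ENNReal.ofReal_natCast,
      ofReal_measureReal (volume_unitBall_ne_top d)]
  refine ⟨r, ?_, ?_⟩
  · rcases hS with rfl | rfl
    · rw [Measure.addHaar_ball _ _ hr0, finrank_euclideanSpace_fin]
    · rw [Measure.addHaar_closedBall _ _ hr0, finrank_euclideanSpace_fin]
  · rw [e]
    rcases hS with rfl | rfl
    · exact perimeter_ball_le hd 0 hr0
    · exact perimeter_closedBall_le hd 0 hr0

end ChargedDrop
end

open ChargedDrop MeasureTheory in
theorem mainTheorem1 (d : ℕ) (hd : 2 ≤ d) (α : ℝ) (hα : 0 < α) (hαd : α < (d : ℝ) - 1)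
    (Q : ℝ) (hQ : 0 < Q) (m : ℝ) (hm : 0 < m)
    (𝒜 : Set (Set (ChargedDrop.Space d)))
    (h𝒜 : 𝒜 = ChargedDrop.openSetsOfVolume d m ∨ 𝒜 = ChargedDrop.compactSetsOfVolume d m) :
    (⨅ E ∈ 𝒜, ChargedDrop.energyF α Q E) = ChargedDrop.ballPerimeter d m ∧
    (⨅ E ∈ 𝒜, ChargedDrop.energyG α Q E) = ChargedDrop.ballPerimeter d m ∧
    IsLeast (ChargedDrop.perimeter '' 𝒜) (ChargedDrop.ballPerimeter d m) ∧
    (¬ ∃ E ∈ 𝒜, IsMinOn (ChargedDrop.energyF α Q) 𝒜 E) ∧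
    (¬ ∃ E ∈ 𝒜, IsMinOn (ChargedDrop.energyG α Q) 𝒜 E) := by
  have hvt : ENNReal.ofReal m ≠ ⊤ := ENNReal.ofReal_ne_top
  have hv0 : ENNReal.ofReal m ≠ 0 := by simpa using hm
  have hQ0 : ENNReal.ofReal (Q ^ 2) ≠ 0 := by simpa using hQ.ne'
  have hQt : ENNReal.ofReal (Q ^ 2) ≠ ⊤ := ENNReal.ofReal_ne_top
  -- Open balls serve the open class and closed balls the compact class; finite unions of them stay
  -- in the class.
  obtain ⟨S, hS, hmem⟩ : ∃ S : Space d → ℝ → Set (Space d),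
      (S = Metric.ball ∨ S = Metric.closedBall) ∧
      ∀ (n : ℕ) (c : Fin n → Space d) (r : Fin n → ℝ),
        volume (⋃ i, S (c i) (r i)) = ENNReal.ofReal m → (⋃ i, S (c i) (r i)) ∈ 𝒜 := by
    rcases h𝒜 with rfl | rfl
    · exact ⟨Metric.ball, Or.inl rfl, fun n c r h => ⟨isOpen_iUnion fun i => Metric.isOpen_ball, h⟩⟩
    · exact ⟨Metric.closedBall, Or.inr rfl, fun n c r h =>
        ⟨isCompact_iUnion fun i => isCompact_closedBall _ _, h⟩⟩
  have hmeas : ∀ E ∈ 𝒜, MeasurableSet E := by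
    rcases h𝒜 with rfl | rfl
    · exact fun E hE => hE.1.measurableSet
    · exact fun E hE => hE.1.measurableSet
  have hvol : ∀ E ∈ 𝒜, volume E = ENNReal.ofReal m := by
    rcases h𝒜 with rfl | rfl
    · exact fun E hE => hE.2
    · exact fun E hE => hE.2
  have hlow : ∀ E ∈ 𝒜, ballPerimeter d m ≤ perimeter E := fun E hE => by
    rw [ballPerimeter_eq_isoProfile hd, ← hvol E hE]
    exact isoProfile_volume_le_perimeter hd (hmeas E hE) (hvol E hE ▸ hvt)
  -- Only the open class uses optimality of the perimeter here.
  have hbdd : ∀ E ∈ 𝒜, perimeter E ≤ ballPerimeter d m → Bornology.IsBounded E := by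
    intro E hE hP
    rw [ballPerimeter_eq_isoProfile hd, ← hvol E hE] at hP
    rcases h𝒜 with rfl | rfl
    · exact isBounded_of_isOpen_of_perimeter_le hd hE.1 (hvol E hE ▸ hvt) (hvol E hE ▸ hv0) hP
    · exact hE.1.isBounded
  have happrox : ∀ δ : ℝ, 0 < δ → ∃ E ∈ 𝒜, perimeter E ≤ ballPerimeter d m + ENNReal.ofReal δ ∧
      rieszEnergy α E ≤ ENNReal.ofReal δ ∧ rieszEnergy α (frontier E) ≤ ENNReal.ofReal δ := by
    intro δ hδ
    obtain ⟨n, c, r, h1, h2, h3, h4⟩ := exists_ball_with_satellites hd hα hαd hS hv0 hvt hδ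
    exact ⟨_, hmem n c r h1, ballPerimeter_eq_isoProfile hd m ▸ h2, h3, h4⟩
  have hp : ballPerimeter d m ≠ ⊤ := by
    rw [ballPerimeter_eq_isoProfile hd]
    exact isoProfile_ne_top hd hvt
  have hF : (⨅ E ∈ 𝒜, energyF α Q E) = ballPerimeter d m :=
    iInf_eq_of_forall_exists_le (I := rieszEnergy α) hQt (fun _ _ => rfl) hlow fun δ hδ =>
      let ⟨E, hE, h1, h2, _⟩ := happrox δ hδ
      ⟨E, hE, h1, h2⟩
  have hG : (⨅ E ∈ 𝒜, energyG α Q E) = ballPerimeter d m :=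
    iInf_eq_of_forall_exists_le (I := fun E => rieszEnergy α (frontier E)) hQt (fun _ _ => rfl)
      hlow fun δ hδ =>
        let ⟨E, hE, h1, _, h2⟩ := happrox δ hδ
        ⟨E, hE, h1, h2⟩
  refine ⟨hF, hG, ⟨?_, ?_⟩, ?_, ?_⟩
  · obtain ⟨r, h1, h2⟩ := exists_ball_of_volume hd hS hvt
    have hB : S 0 r ∈ 𝒜 := by
      have h3 : (⋃ _ : Fin 1, S 0 r) = S 0 r := Set.iUnion_const _
      exact h3 ▸ hmem 1 (fun _ => 0) (fun _ => r) (h3.symm ▸ h1)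
    exact ⟨S 0 r, hB, le_antisymm (ballPerimeter_eq_isoProfile hd m ▸ h2) (hlow _ hB)⟩
  · rintro _ ⟨E, hE, rfl⟩
    exact hlow E hE
  · exact not_exists_isMinOn_of_iInf_eq (I := rieszEnergy α) hp hQ0 (fun _ _ => rfl) hlow hF
      fun E hE hP => rieszEnergy_ne_zero_of_isBounded hα (hmeas E hE) (hbdd E hE hP)
  · refine not_exists_isMinOn_of_iInf_eq (I := fun E => rieszEnergy α (frontier E)) hp hQ0
      (fun _ _ => rfl) hlow hG fun E hE hP => ?_
    exact rieszEnergy_ne_zero_of_isBounded hα isClosed_frontier.measurableSet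
      ((hbdd E hE hP).closure.subset frontier_subset_closure)
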